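/- Let $X$ be a non-empty compact Hausdorff space and $\sigma:X\to X$ a homeomorphism. Let $\ell^1(\Sigma)=\ell^1(\mathbb Z,C(X))$ be the associated unital Banach algebra, with norm $\|a\|=\sum_n\|a(n)\|_\infty$ and multiplication $(ab)(n)=\sum_k a(k)\,\alpha^k(b(n-k))$, where $\alpha(f)=f\circ\sigma^{-1}$; write $a=\sum_n f_n\delta^n$ with $f_n=a(n)$. Its structure space is the set of primitive ideals, i.e. kernels of algebraically irreducible representations on complex vector spaces, with the hull-kernel topology: the closure of a set $F$ of primitive ideals is the set of primitive ideals containing $\bigcap_{P\in F}P$. For $p\ge1$ let $\mathrm{Per}_p(\sigma)$ be the set of points whose orbit has exactly $p$ elements, and let $\mathrm{Per}(\sigma)=\bigcup_{p\ge1}\mathrm{Per}_p(\sigma)$. For $x\in\mathrm{Per}_p(\sigma)$ and $\lambda\in\mathbb T$ let $\pi_{x,\lambda}$ be the representation of $\ell^1(\Sigma)$ on $\mathbb C^p$ (with standard basis $e_0,\dots,e_{p-1}$) given by $\pi_{x,\lambda}(\sum_n f_n\delta^n)=\sum_n\rho_x(f_n)T_\lambda^n$, where $\rho_x(f)e_j=f(\sigma^jx)e_j$,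 $T_\lambda e_j=e_{j+1}$ for $0\le j<p-1$, and $T_\lambda e_{p-1}=\lambda e_0$. Its kernel is a primitive ideal depending only on $\lambda$ and the orbit $\mathfrak o$ of $x$, denoted $P_{\mathfrak o,\lambda}$. For $x\notin\mathrm{Per}(\sigma)$ let $\pi_x^1$ be the representation of $\ell^1(\Sigma)$ on $\ell^1(\mathbb Z)$ in which $f\in C(X)$ acts by $e_k\mapsto f(\sigma^kx)e_k$ and $\delta$ acts as the right shift $e_k\mapsto e_{k+1}$; its kernel is a primitive ideal depending only on the closure of the orbit of $x$. For an invariant set $S\subset X$ (that is, $\sigma(S)=S$) let $\Pi_S$ be the set of the primitive ideals $\ker\pi_{x,\lambda}$ ($x\in S\cap\mathrm{Per}(\sigma)$, $\lambda\in\mathbb T$) and $\ker\pi_x^1$ ($x\in S\setminus\mathrm{Per}(\sigma)$), with the topology induced from the structure space, and for invariant $S\subset\mathrm{Per}(\sigma)$ let $S/\mathbb Z$ be the space of orbits in $S$ with the quotient topology. Theorem. (1) If $X$ is metrizable or $X=\mathrm{Per}(\sigma)$, then $\Pi_X$ is compact. (2) Suppose that $\Pi_X$ is compact. Let $S_1,\dots,S_n$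 be mutually disjoint closed invariant subsets of $X$ such that $S_i\subset\mathrm{Per}_{p_i}(\sigma)$ for not necessarily different integers $p_1,\dots,p_n\ge1$, and let $S=\bigcup_{i=1}^nS_i$. Then the map $\Psi:(S/\mathbb Z)\times\mathbb T\to\Pi_S$, $(\mathfrak o,\lambda)\mapsto P_{\mathfrak o,\lambda}$, is a homeomorphism between compact Hausdorff spaces. Moreover, $\Pi_S$ is the topological disjoint union of its subspaces $\Pi_{S_1},\dots,\Pi_{S_n}$ (the inclusions induce a homeomorphism $\bigsqcup_{i=1}^n\Pi_{S_i}\to\Pi_S$), and, for each $i$, the map $(\mathfrak o,\lambda)\mapsto P_{\mathfrak o,\lambda}$ is a homeomorphism from $(S_i/\mathbb Z)\times\mathbb T$ onto $\Pi_{S_i}$. -/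

import Mathlib

open Set Topology

universe u

set_option linter.unusedSectionVars false

/-- `α^k (f) = f ∘ σ^{-k}` -/
noncomputable def alphaPow {X : Type u} [TopologicalSpace X] (σ : X ≃ₜ X) (k : ℤ) (f : C(X, ℂ)) : C(X, ℂ) :=
  f.comp ((σ ^ (-k) : X ≃ₜ X) : C(X, X))

/-- `ℓ¹(Σ) = ℓ¹(ℤ, C(X))` for `Σ = (X, σ)`, with norm `‖a‖ = ∑ ‖a(n)‖`. The ring structure defined
below (twisted convolution) depends on `σ`. -/
def EllOne {X : Type u} [TopologicalSpace X] [CompactSpace X] (_σ : X ≃ₜ X) : Type u :=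
  lp (fun _ : ℤ => C(X, ℂ)) 1

namespace EllOne

variable {X : Type u} [TopologicalSpace X] [CompactSpace X] {σ : X ≃ₜ X}

noncomputable instance : NormedAddCommGroup (EllOne σ) :=
  inferInstanceAs (NormedAddCommGroup (lp (fun _ : ℤ => C(X, ℂ)) 1))

noncomputable instance : NormedSpace ℂ (EllOne σ) :=
  inferInstanceAs (NormedSpace ℂ (lp (fun _ : ℤ => C(X, ℂ)) 1))

instance : CompleteSpace (EllOne σ) :=
  inferInstanceAs (CompleteSpace (lp (fun _ : ℤ => C(X, ℂ)) 1))

/-- `a n` is the coefficient `f_n` of `a = ∑ f_n δ^n`. -/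
instance : CoeFun (EllOne σ) (fun _ => ℤ → C(X, ℂ)) := ⟨fun a => a.1⟩

@[ext] theorem ext {a b : EllOne σ} (h : ∀ n, a n = b n) : a = b := Subtype.ext (funext h)

@[simp] theorem add_apply (a b : EllOne σ) (n : ℤ) : (a + b) n = a n + b n := rfl
@[simp] theorem smul_apply (c : ℂ) (a : EllOne σ) (n : ℤ) : (c • a) n = c • a n := rfl

theorem summable_norm (a : EllOne σ) : Summable fun n => ‖a n‖ := by
  have := (lp.hasSum_norm (p := 1) (by simp) (show lp (fun _ : ℤ => C(X, ℂ)) 1 from a)).summable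
  simpa using this

theorem norm_eq (a : EllOne σ) : ‖a‖ = ∑' n, ‖a n‖ := by
  have := lp.norm_eq_tsum_rpow (p := 1) (by simp) (show lp (fun _ : ℤ => C(X, ℂ)) 1 from a)
  simp only [ENNReal.toReal_one, Real.rpow_one, div_one] at this
  exact this

theorem norm_alphaPow_le (k : ℤ) (f : C(X, ℂ)) : ‖alphaPow σ k f‖ ≤ ‖f‖ :=
  (ContinuousMap.norm_le _ (norm_nonneg _)).2 fun _ => f.norm_coe_le_norm _

/-- An element of the algebra from an absolutely summable family of coefficients. -/
def mk (f : ℤ → C(X, ℂ)) (hf : Summable fun n => ‖f n‖) : EllOne σ :=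
  ⟨f, memℓp_gen (by simpa using hf)⟩

@[simp] theorem mk_apply (f : ℤ → C(X, ℂ)) (hf : Summable fun n => ‖f n‖) (n : ℤ) :
    (mk f hf : EllOne σ) n = f n := rfl

/-- `f δ^n`. -/
noncomputable def single (σ : X ≃ₜ X) (n : ℤ) : C(X, ℂ) →L[ℂ] EllOne σ :=
  lp.singleContinuousLinearMap ℂ (fun _ : ℤ => C(X, ℂ)) 1 n

theorem single_apply (n : ℤ) (f : C(X, ℂ)) (m : ℤ) :
    single σ n f m = if m = n then f else 0 := by
  have := lp.single_apply (E := fun _ : ℤ => C(X, ℂ)) 1 n f m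
  simp only [Pi.single_apply] at this
  exact this

@[simp] theorem norm_single (n : ℤ) (f : C(X, ℂ)) : ‖single σ n f‖ = ‖f‖ :=
  lp.norm_single (E := fun _ : ℤ => C(X, ℂ)) (p := 1) (by simp) n f

theorem clm_ext {F : Type*} [NormedAddCommGroup F] [NormedSpace ℂ F] {S T : EllOne σ →L[ℂ] F}
    (h : ∀ n f, S (single σ n f) = T (single σ n f)) : S = T :=
  lp.ext_continuousLinearMap (E := fun _ : ℤ => C(X, ℂ)) (p := 1) (by simp) fun n =>
    ContinuousLinearMap.ext fun f => h n f

theorem summable_mul_aux (a b : EllOne σ) :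
    Summable fun q : ℤ × ℤ => ‖a q.1 * alphaPow σ q.1 (b (q.2 - q.1))‖ := by
  let e : ℤ × ℤ ≃ ℤ × ℤ :=
    { toFun := fun q => (q.1, q.2 - q.1), invFun := fun q => (q.1, q.2 + q.1)
      left_inv := fun q => by simp, right_inv := fun q => by simp }
  have h := (summable_norm a).mul_of_nonneg (summable_norm b) (fun _ => norm_nonneg _)
    (fun _ => norm_nonneg _)
  refine Summable.of_nonneg_of_le (fun _ => norm_nonneg _) (fun q => ?_) (e.summable_iff.2 h)
  exact (norm_mul_le _ _).trans (mul_le_mul_of_nonneg_left (norm_alphaPow_le _ _) (norm_nonneg _))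

theorem summable_mul_norm (a b : EllOne σ) :
    Summable fun n : ℤ => ‖∑' k, a k * alphaPow σ k (b (n - k))‖ := by
  have h := summable_mul_aux a b
  have h2 := ((Equiv.prodComm ℤ ℤ).summable_iff.2 h)
  refine Summable.of_nonneg_of_le (fun _ => norm_nonneg _) (fun n => ?_) h2.prod
  exact norm_tsum_le_tsum_norm (h2.prod_factor n)

/-- Twisted convolution: `(ab)(n) = ∑_k a(k) α^k(b(n-k))`. -/
noncomputable instance : Mul (EllOne σ) :=
  ⟨fun a b => mk (fun n => ∑' k, a k * alphaPow σ k (b (n - k))) (summable_mul_norm a b)⟩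

theorem mul_apply (a b : EllOne σ) (n : ℤ) :
    (a * b) n = ∑' k, a k * alphaPow σ k (b (n - k)) := rfl

/-- The identity `χ_{0} = 1·δ^0`. -/
noncomputable instance : One (EllOne σ) := ⟨single σ 0 1⟩

theorem one_def : (1 : EllOne σ) = single σ 0 1 := rfl

theorem summable_mul_apply (a b : EllOne σ) (n : ℤ) :
    Summable fun k => a k * alphaPow σ k (b (n - k)) :=
  Summable.of_norm (((Equiv.prodComm ℤ ℤ).summable_iff.2 (summable_mul_aux a b)).prod_factor n)

protected theorem norm_mul_le (a b : EllOne σ) : ‖a * b‖ ≤ ‖a‖ * ‖b‖ := by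
  have h := summable_mul_aux a b
  have h2 := ((Equiv.prodComm ℤ ℤ).summable_iff.2 h)
  calc ‖a * b‖ = ∑' n, ‖∑' k, a k * alphaPow σ k (b (n - k))‖ := norm_eq _
    _ ≤ ∑' n, ∑' k, ‖a k * alphaPow σ k (b (n - k))‖ :=
        (summable_mul_norm a b).tsum_le_tsum (fun n => norm_tsum_le_tsum_norm (h2.prod_factor n))
          h2.prod
    _ = ∑' k, ∑' n, ‖a k * alphaPow σ k (b (n - k))‖ := Summable.tsum_comm (f := fun k n => ‖a k * alphaPow σ k (b (n - k))‖) h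
    _ ≤ ∑' k, ‖a k‖ * ‖b‖ := by
        refine h.prod.tsum_le_tsum (fun k => ?_) ((summable_norm a).mul_right _)
        have hs : Summable fun n => ‖a k‖ * ‖b (n - k)‖ :=
          (((Equiv.subRight k).summable_iff).2 (summable_norm b)).mul_left _
        refine ((h.prod_factor k).tsum_le_tsum (fun n => ?_) hs).trans (le_of_eq ?_)
        · exact (norm_mul_le _ _).trans
            (mul_le_mul_of_nonneg_left (norm_alphaPow_le _ _) (norm_nonneg _))
        · rw [tsum_mul_left, norm_eq b]
          congr 1
          exact (Equiv.subRight k).tsum_eq fun n => ‖b n‖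
    _ = ‖a‖ * ‖b‖ := by rw [tsum_mul_right, norm_eq a]

theorem alphaPow_add (k : ℤ) (f g : C(X, ℂ)) :
    alphaPow σ k (f + g) = alphaPow σ k f + alphaPow σ k g := rfl
theorem alphaPow_mul (k : ℤ) (f g : C(X, ℂ)) :
    alphaPow σ k (f * g) = alphaPow σ k f * alphaPow σ k g := rfl
theorem alphaPow_smul (k : ℤ) (c : ℂ) (f : C(X, ℂ)) :
    alphaPow σ k (c • f) = c • alphaPow σ k f := rfl
theorem alphaPow_alphaPow (k l : ℤ) (f : C(X, ℂ)) :
    alphaPow σ k (alphaPow σ l f) = alphaPow σ (k + l) f := by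
  ext x
  simp only [alphaPow, ContinuousMap.comp_apply, neg_add, zpow_add]
  rw [← zpow_add, add_comm, zpow_add]; rfl

/-- Multiplication as a continuous bilinear map. -/
noncomputable def mulL (σ : X ≃ₜ X) : EllOne σ →L[ℂ] EllOne σ →L[ℂ] EllOne σ :=
  LinearMap.mkContinuous₂
    (LinearMap.mk₂ ℂ (fun a b : EllOne σ => a * b)
      (fun a a' b => ext fun n => by
        simp only [mul_apply, add_apply, add_mul]
        exact (summable_mul_apply a b n).tsum_add (summable_mul_apply a' b n))
      (fun c a b => ext fun n => by
        simp only [mul_apply, smul_apply, smul_mul_assoc]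
        exact (summable_mul_apply a b n).tsum_const_smul c)
      (fun a b b' => ext fun n => by
        simp only [mul_apply, add_apply, alphaPow_add, mul_add]
        exact (summable_mul_apply a b n).tsum_add (summable_mul_apply a b' n))
      (fun c a b => ext fun n => by
        simp only [mul_apply, smul_apply, alphaPow_smul, mul_smul_comm]
        exact (summable_mul_apply a b n).tsum_const_smul c))
    1 (fun a b => by simpa using EllOne.norm_mul_le a b)

@[simp] theorem mulL_apply (a b : EllOne σ) : mulL σ a b = a * b := rfl

theorem single_mul_single (m n : ℤ) (f g : C(X, ℂ)) :
    single σ m f * single σ n g = single σ (m + n) (f * alphaPow σ m g) := by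
  ext1 k
  rw [mul_apply, tsum_eq_single m]
  · simp only [single_apply, if_true]
    by_cases h : k = m + n
    · simp [h]
    · have : ¬ (k - m = n) := fun h' => h (by omega)
      simp only [h, this, if_false]
      ext x; simp [alphaPow]
  · intro j hj
    simp [single_apply, hj]

protected theorem mul_assoc (a b c : EllOne σ) : a * b * c = a * (b * c) := by
  let M := mulL σ
  have key : (ContinuousLinearMap.compL ℂ (EllOne σ) (EllOne σ) (EllOne σ →L[ℂ] EllOne σ) M).comp M
      = ((ContinuousLinearMap.compL ℂ (EllOne σ) (EllOne σ →L[ℂ] EllOne σ)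
          (EllOne σ →L[ℂ] EllOne σ)).flip M).comp
          ((ContinuousLinearMap.compL ℂ (EllOne σ) (EllOne σ) (EllOne σ)).comp M) := by
    refine clm_ext fun i f => clm_ext fun j g => clm_ext fun k h => ?_
    change single σ i f * single σ j g * single σ k h = single σ i f * (single σ j g * single σ k h)
    simp only [single_mul_single, alphaPow_mul, alphaPow_alphaPow, add_assoc, mul_assoc]
  exact congrArg (fun T => T a b c) key

protected theorem one_mul (a : EllOne σ) : 1 * a = a := by
  have key : mulL σ 1 = ContinuousLinearMap.id ℂ _ := clm_ext fun n f => by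
    change 1 * single σ n f = single σ n f
    rw [one_def, single_mul_single, zero_add, one_mul]
    congr 1
  exact congrArg (fun T => T a) key

protected theorem mul_one (a : EllOne σ) : a * 1 = a := by
  have key : (mulL σ).flip 1 = ContinuousLinearMap.id ℂ _ := clm_ext fun n f => by
    change single σ n f * 1 = single σ n f
    rw [one_def, single_mul_single, add_zero]
    congr 1
    ext x; simp [alphaPow]
  exact congrArg (fun T => T a) key

noncomputable instance : NormedRing (EllOne σ) :=
  { (inferInstance : NormedAddCommGroup (EllOne σ)) with
    mul := fun a b => a * b
    one := 1
    left_distrib := fun a b c => (mulL σ a).map_add b c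
    right_distrib := fun a b c => (mulL σ).map_add₂ a b c
    zero_mul := fun a => (mulL σ).map_zero₂ a
    mul_zero := fun a => (mulL σ a).map_zero
    mul_assoc := EllOne.mul_assoc
    one_mul := EllOne.one_mul
    mul_one := EllOne.mul_one
    norm_mul_le := EllOne.norm_mul_le }

noncomputable instance : Algebra ℂ (EllOne σ) :=
  Algebra.ofModule (fun c a b => (mulL σ).map_smul₂ c a b) (fun c a b => (mulL σ a).map_smul c b)

noncomputable instance : NormedAlgebra ℂ (EllOne σ) :=
  { (inferInstance : Algebra ℂ (EllOne σ)) with norm_smul_le := fun c a => (norm_smul c a).le }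

end EllOne

/-- A (not necessarily unital) representation `π` of `A` on `E` is algebraically irreducible if
`π(A)E ≠ {0}` and the only invariant subspaces of `E` are `{0}` and `E`. -/
def IsAlgebraicallyIrreducible {A : Type*} [Ring A] [Algebra ℂ A] {E : Type*} [AddCommGroup E]
    [Module ℂ E] (π : A →ₙₐ[ℂ] Module.End ℂ E) : Prop :=
  (∃ a e, π a e ≠ 0) ∧
    ∀ W : Submodule ℂ E, (∀ a, ∀ w ∈ W, π a w ∈ W) → W = ⊥ ∨ W = ⊤

/-- Primitive ideals are the kernels of algebraically irreducible representations on complex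
vector spaces. It is no restriction to take these spaces in the universe of `A`, since an
algebraically irreducible representation of `A` is equivalent to one on a quotient of `A`. -/
def IsPrimitiveIdeal {A : Type u} [Ring A] [Algebra ℂ A] (I : TwoSidedIdeal A) : Prop :=
  ∃ (E : Type u) (_ : AddCommGroup E) (_ : Module ℂ E) (π : A →ₙₐ[ℂ] Module.End ℂ E),
    IsAlgebraicallyIrreducible π ∧ I = TwoSidedIdeal.ker π

/-- The set of primitive ideals of `A`. -/
def StructureSpace (A : Type u) [Ring A] [Algebra ℂ A] : Type u :=
  {I : TwoSidedIdeal A // IsPrimitiveIdeal I}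

namespace StructureSpace

variable {A : Type u} [Ring A] [Algebra ℂ A]

/-- The underlying two-sided ideal. -/
def ideal (P : StructureSpace A) : TwoSidedIdeal A := P.1

/-- The kernel `k(F) = ⋂_{P ∈ F} P`. -/
def kernel (F : Set (StructureSpace A)) : TwoSidedIdeal A := sInf (ideal '' F)

/-- The hull of an ideal: the primitive ideals containing it. -/
def hull (I : TwoSidedIdeal A) : Set (StructureSpace A) := {P | I ≤ P.ideal}

theorem kernel_le {F : Set (StructureSpace A)} {P : StructureSpace A} (h : P ∈ F) :
    kernel F ≤ P.ideal := sInf_le (mem_image_of_mem _ h)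

theorem kernel_anti {F G : Set (StructureSpace A)} (h : F ⊆ G) : kernel G ≤ kernel F :=
  sInf_le_sInf (image_mono h)

theorem mem_kernel {F : Set (StructureSpace A)} {a : A} :
    a ∈ kernel F ↔ ∀ P ∈ F, a ∈ P.ideal := by
  simp [kernel, TwoSidedIdeal.mem_sInf]

theorem hull_anti {I J : TwoSidedIdeal A} (h : I ≤ J) : hull J ⊆ hull I :=
  fun _ hP => le_trans h hP

theorem subset_hull_kernel (F : Set (StructureSpace A)) : F ⊆ hull (kernel F) :=
  fun _ h => kernel_le h

theorem exists_mul_mul_notMem (P : StructureSpace A) {a b : A} (ha : a ∉ P.ideal)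
    (hb : b ∉ P.ideal) : ∃ c, a * c * b ∉ P.ideal := by
  obtain ⟨I, E, _, _, π, ⟨⟨a₀, e₀, h₀⟩, hirr⟩, rfl⟩ := P
  change a ∉ TwoSidedIdeal.ker π at ha
  change b ∉ TwoSidedIdeal.ker π at hb
  change ∃ c, a * c * b ∉ TwoSidedIdeal.ker π
  simp only [TwoSidedIdeal.mem_ker] at ha hb ⊢
  by_contra! hc
  obtain ⟨e, he⟩ : ∃ e, π b e ≠ 0 := by
    by_contra! h
    exact hb (LinearMap.ext h)
  let N : Submodule ℂ E :=
    { carrier := {v | ∀ c, π c v = 0}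
      zero_mem' := fun c => map_zero _
      add_mem' := fun hx hy c => by rw [map_add, hx c, hy c, add_zero]
      smul_mem' := fun r x hx c => by rw [map_smul, hx c, smul_zero] }
  have hN : N = ⊥ := by
    refine (hirr N fun c w hw d => ?_).resolve_right fun h => ?_
    · rw [hw c, map_zero]
    · exact h₀ ((h ▸ Submodule.mem_top : e₀ ∈ N) a₀)
  let W : Submodule ℂ E :=
    { carrier := {v | ∃ c, π c (π b e) = v}
      zero_mem' := ⟨0, by simp⟩
      add_mem' := by
        rintro _ _ ⟨c, rfl⟩ ⟨d, rfl⟩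
        exact ⟨c + d, by simp⟩
      smul_mem' := by
        rintro r _ ⟨c, rfl⟩
        exact ⟨r • c, by simp⟩ }
  have hW : W = ⊤ := by
    refine (hirr W ?_).resolve_left fun h => ?_
    · rintro d _ ⟨c, rfl⟩
      exact ⟨d * c, by simp⟩
    · have : π b e ∈ N := fun c => by
        have : π c (π b e) ∈ W := ⟨c, rfl⟩
        simpa [h] using this
      rw [hN] at this
      exact he (by simpa using this)
  refine ha (LinearMap.ext fun v => ?_)
  obtain ⟨c, hcv⟩ : v ∈ W := hW ▸ Submodule.mem_top
  have := LinearMap.congr_fun (hc c) e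
  simp only [map_mul, Module.End.mul_apply, LinearMap.zero_apply] at this
  rw [← hcv, this, LinearMap.zero_apply]

/-- The hull-kernel topology: `F` is closed iff it contains the hull of its kernel. -/
instance : TopologicalSpace (StructureSpace A) :=
  TopologicalSpace.ofClosed {F | hull (kernel F) ⊆ F}
    (by
      rintro P hP
      obtain ⟨E, _, _, π, ⟨⟨a, e, h⟩, -⟩, hI⟩ := P.2
      have : a ∈ P.ideal := hP (mem_kernel.2 fun _ h => h.elim)
      have h2 : a ∈ TwoSidedIdeal.ker π := hI ▸ this
      rw [TwoSidedIdeal.mem_ker] at h2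
      exact (h (by rw [h2]; rfl)).elim)
    (fun T hT P hP F hF => hT hF (hull_anti (kernel_anti (sInter_subset_of_mem hF)) hP))
    (fun F hF G hG P hP => by
      by_contra hn
      obtain ⟨a, haF, haP⟩ : ∃ a ∈ kernel F, a ∉ P.ideal := by
        by_contra! h
        exact hn (Or.inl (hF fun a ha => h a ha))
      obtain ⟨b, hbG, hbP⟩ : ∃ b ∈ kernel G, b ∉ P.ideal := by
        by_contra! h
        exact hn (Or.inr (hG fun a ha => h a ha))
      obtain ⟨c, hc⟩ := exists_mul_mul_notMem P haP hbP
      refine hc (hP (mem_kernel.2 ?_))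
      rintro Q (hQ | hQ)
      · exact Q.ideal.mul_mem_right _ _ (Q.ideal.mul_mem_right _ _ (kernel_le hQ haF))
      · exact Q.ideal.mul_mem_left _ _ (kernel_le hQ hbG))

theorem isClosed_iff {F : Set (StructureSpace A)} : IsClosed F ↔ hull (kernel F) ⊆ F := by
  rw [← isOpen_compl_iff]
  change Fᶜᶜ ∈ _ ↔ _
  rw [compl_compl]; rfl

/-- The closure of `F` in the hull-kernel topology is the hull of the kernel of `F`. -/
theorem closure_eq (F : Set (StructureSpace A)) : closure F = hull (kernel F) := by
  refine subset_antisymm (closure_minimal (subset_hull_kernel F) (isClosed_iff.2 ?_)) fun P hP => ?_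
  · exact hull_anti fun a ha => mem_kernel.2 fun Q hQ => hQ ha
  · exact isClosed_iff.1 isClosed_closure (hull_anti (kernel_anti subset_closure) hP)

end StructureSpace

/-- A covariant pair: a bounded unital representation `ρ` of `C(X)` in a Banach algebra `B` together
with an invertible, two-sided power bounded `T` such that `ρ(α(f)) = T ρ(f) T⁻¹`. -/
structure CovariantPair {X : Type u} [TopologicalSpace X] [CompactSpace X] (σ : X ≃ₜ X)
    (B : Type*) [NormedRing B] [NormedAlgebra ℂ B] where
  ρ : C(X, ℂ) →ₐ[ℂ] B
  T : Bˣ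
  bound_ρ : ∃ C : ℝ, ∀ f, ‖ρ f‖ ≤ C * ‖f‖
  bound_T : ∃ M : ℝ, ∀ n : ℤ, ‖((T ^ n : Bˣ) : B)‖ ≤ M
  covariant : ∀ f, ρ (alphaPow σ 1 f) = T * ρ f * ((T⁻¹ : Bˣ) : B)

namespace CovariantPair

variable {X : Type u} [TopologicalSpace X] [CompactSpace X] {σ : X ≃ₜ X}
  {B : Type*} [NormedRing B] [NormedAlgebra ℂ B]

theorem bound (V : CovariantPair σ B) :
    ∃ K : ℝ, ∀ f (n : ℤ), ‖V.ρ f * ((V.T ^ n : Bˣ) : B)‖ ≤ K * ‖f‖ := by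
  obtain ⟨C, hC⟩ := V.bound_ρ
  obtain ⟨M, hM⟩ := V.bound_T
  refine ⟨C * M, fun f n => (norm_mul_le _ _).trans ?_⟩
  calc ‖V.ρ f‖ * ‖((V.T ^ n : Bˣ) : B)‖ ≤ C * ‖f‖ * M :=
        mul_le_mul (hC f) (hM n) (norm_nonneg _) ((norm_nonneg _).trans (hC f))
    _ = C * M * ‖f‖ := by ring

theorem commute (V : CovariantPair σ B) (n : ℤ) :
    ∀ f, ((V.T ^ n : Bˣ) : B) * V.ρ f = V.ρ (alphaPow σ n f) * ((V.T ^ n : Bˣ) : B) := by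
  have h1 : ∀ f, (V.T : B) * V.ρ f = V.ρ (alphaPow σ 1 f) * V.T := fun f => by
    rw [V.covariant, mul_assoc, Units.inv_mul, mul_one]
  have h2 : ∀ f, ((V.T⁻¹ : Bˣ) : B) * V.ρ f
      = V.ρ (alphaPow σ (-1) f) * ((V.T⁻¹ : Bˣ) : B) := fun f => by
    have := h1 (alphaPow σ (-1) f)
    rw [EllOne.alphaPow_alphaPow] at this
    have h0 : alphaPow σ (1 + -1) f = f := by ext x; simp [alphaPow]
    rw [h0] at this
    rw [Units.inv_mul_eq_iff_eq_mul, ← mul_assoc, this, mul_assoc, Units.mul_inv, mul_one]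
  induction n with
  | zero => intro f; have h0 : alphaPow σ 0 f = f := by { ext x; simp [alphaPow] }
            simp [h0]
  | succ k ih =>
    intro f
    rw [add_comm, zpow_add, zpow_one, Units.val_mul, mul_assoc, ih, ← mul_assoc, h1,
      EllOne.alphaPow_alphaPow, mul_assoc]
  | pred k ih =>
    intro f
    rw [sub_eq_add_neg, add_comm, zpow_add, zpow_neg_one, Units.val_mul, mul_assoc, ih,
      ← mul_assoc, h2, EllOne.alphaPow_alphaPow, mul_assoc]

variable [CompleteSpace B]

theorem summable (V : CovariantPair σ B) (a : EllOne σ) :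
    Summable fun n : ℤ => V.ρ (a n) * ((V.T ^ n : Bˣ) : B) := by
  obtain ⟨K, hK⟩ := V.bound
  exact Summable.of_norm_bounded ((EllOne.summable_norm a).mul_left K) fun n => hK _ n

/-- `∑ f_n δ^n ↦ ∑ ρ(f_n) T^n` as a continuous linear map. -/
noncomputable def toCLM (V : CovariantPair σ B) : EllOne σ →L[ℂ] B :=
  LinearMap.mkContinuousOfExistsBound
    { toFun := fun a => ∑' n : ℤ, V.ρ (a n) * ((V.T ^ n : Bˣ) : B)
      map_add' := fun a b => by
        simp only [EllOne.add_apply, map_add, add_mul]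
        exact (V.summable a).tsum_add (V.summable b)
      map_smul' := fun c a => by
        simp only [EllOne.smul_apply, map_smul, smul_mul_assoc, RingHom.id_apply]
        exact (V.summable a).tsum_const_smul c }
    (by
      obtain ⟨K, hK⟩ := V.bound
      refine ⟨K, fun a => ?_⟩
      rw [EllOne.norm_eq, ← tsum_mul_left]
      exact tsum_of_norm_bounded ((EllOne.summable_norm a).mul_left K).hasSum fun n => hK _ n)

theorem toCLM_apply (V : CovariantPair σ B) (a : EllOne σ) :
    V.toCLM a = ∑' n : ℤ, V.ρ (a n) * ((V.T ^ n : Bˣ) : B) := rfl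

theorem toCLM_single (V : CovariantPair σ B) (n : ℤ) (f : C(X, ℂ)) :
    V.toCLM (EllOne.single σ n f) = V.ρ f * ((V.T ^ n : Bˣ) : B) := by
  rw [toCLM_apply, tsum_eq_single n]
  · simp [EllOne.single_apply]
  · intro m hm
    simp [EllOne.single_apply, hm]

theorem toCLM_mul (V : CovariantPair σ B) (a b : EllOne σ) :
    V.toCLM (a * b) = V.toCLM a * V.toCLM b := by
  have key : (ContinuousLinearMap.compL ℂ (EllOne σ) (EllOne σ) B V.toCLM).comp (EllOne.mulL σ)
      = ((ContinuousLinearMap.compL ℂ (EllOne σ) B B).flip V.toCLM).comp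
          ((ContinuousLinearMap.mul ℂ B).comp V.toCLM) := by
    refine EllOne.clm_ext fun i f => EllOne.clm_ext fun j g => ?_
    change V.toCLM (EllOne.single σ i f * EllOne.single σ j g)
      = V.toCLM (EllOne.single σ i f) * V.toCLM (EllOne.single σ j g)
    rw [EllOne.single_mul_single, toCLM_single, toCLM_single, toCLM_single, map_mul, zpow_add,
      Units.val_mul, mul_assoc, mul_assoc, ← mul_assoc _ (V.ρ g), V.commute]
    simp only [mul_assoc]
  exact congrArg (fun S => S a b) key

/-- The representation `∑ f_n δ^n ↦ ∑ ρ(f_n) T^n` of the algebra given by a covariant pair. -/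
noncomputable def integrate (V : CovariantPair σ B) : EllOne σ →ₐ[ℂ] B :=
  AlgHom.ofLinearMap V.toCLM.toLinearMap
    (by
      change V.toCLM 1 = 1
      rw [EllOne.one_def, toCLM_single]; simp)
    (fun a b => V.toCLM_mul a b)

theorem integrate_apply (V : CovariantPair σ B) (a : EllOne σ) :
    V.integrate a = ∑' n : ℤ, V.ρ (a n) * ((V.T ^ n : Bˣ) : B) := rfl

end CovariantPair

section Periodic

variable {X : Type u} [TopologicalSpace X] [CompactSpace X]

/-- The matrix of `T_λ`: `e_j ↦ e_{j+1}` for `j < p - 1` and `e_{p-1} ↦ λ e_0`. -/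
def twistMatrix (p : ℕ) (lam : Circle) : Matrix (Fin p) (Fin p) ℂ :=
  Matrix.of fun i j =>
    if (i : ℕ) = j + 1 then 1 else if (i : ℕ) = 0 ∧ (j : ℕ) + 1 = p then (lam : ℂ) else 0

/-- `twistMatrix` is a weighted permutation matrix. -/
theorem twistMatrix_apply (p : ℕ) (lam : Circle) (i j : Fin p) :
    twistMatrix p lam i j =
      if i = finRotate p j then (if (j : ℕ) + 1 = p then (lam : ℂ) else 1) else 0 := by
  obtain _ | p := p
  · exact i.elim0
  rcases eq_or_ne j (Fin.last p) with rfl | hj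
  · have hi := i.2
    simp only [twistMatrix, Matrix.of_apply, finRotate_last, Fin.val_last, Fin.ext_iff,
      Fin.val_zero]
    have : ¬ (i : ℕ) = p + 1 := by omega
    simp [this]
  · have hlt : (j : ℕ) < p := lt_of_le_of_ne (Nat.lt_succ_iff.1 j.2) fun h => hj (Fin.ext h)
    have h1 : ¬ (j : ℕ) + 1 = p + 1 := by omega
    have h2 : (finRotate (p + 1) j : ℕ) = j + 1 := by
      have := coe_finRotate_of_ne_last hj
      exact this
    simp only [twistMatrix, Matrix.of_apply, Fin.ext_iff, h2, h1, and_false, if_false]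

theorem twistMatrix_mem_unitary (p : ℕ) (lam : Circle) :
    twistMatrix p lam ∈ unitary (Matrix (Fin p) (Fin p) ℂ) := by
  have h : star (twistMatrix p lam) * twistMatrix p lam = 1 := by
    ext i j
    rw [Matrix.mul_apply, Finset.sum_eq_single (finRotate p i)]
    · simp only [Matrix.star_apply, twistMatrix_apply, if_true, (finRotate p).injective.eq_iff]
      by_cases hij : i = j
      · subst hij
        simp only [if_true, Matrix.one_apply_eq]
        split_ifs
        · rw [RCLike.star_def, Complex.conj_mul', Circle.norm_coe]; simp
        · simp
      · simp [hij]
    · intro k _ hk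
      rw [Matrix.star_apply, twistMatrix_apply, if_neg hk, star_zero, zero_mul]
    · simp
  exact ⟨h, mul_eq_one_comm.1 h⟩

theorem twistMatrix_mul_diagonal (p : ℕ) (lam : Circle) (d d' : Fin p → ℂ)
    (h : ∀ j, d' (finRotate p j) = d j) :
    twistMatrix p lam * Matrix.diagonal d = Matrix.diagonal d' * twistMatrix p lam := by
  ext i j
  rw [Matrix.mul_diagonal, Matrix.diagonal_mul, twistMatrix_apply]
  split_ifs with h1
  · rw [h1, h, mul_comm]
  · rw [h1, h, mul_comm]
  · simp

theorem iterate_finRotate {Y : Type*} (g : Y ≃ Y) (x : Y)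
    (j : Fin (Function.minimalPeriod g x)) :
    g.symm (g^[(finRotate _ j : ℕ)] x) = g^[(j : ℕ)] x := by
  rw [Equiv.symm_apply_eq, ← Function.iterate_succ_apply' g]
  have hp := Function.iterate_minimalPeriod (f := g) (x := x)
  generalize hq : Function.minimalPeriod g x = p at *
  obtain _ | p := p
  · exact j.elim0
  rcases eq_or_ne j (Fin.last p) with rfl | hj
  · rw [finRotate_last, Fin.val_last]
    simpa using hp.symm
  · rw [coe_finRotate_of_ne_last hj]

/-- The Hilbert space with orthonormal basis `e_0, …, e_{p-1}`. -/
abbrev PeriodicSpace (p : ℕ) : Type := EuclideanSpace ℂ (Fin p)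

/-- `f ↦ diag(f(y_0), …, f(y_{p-1}))` as matrices. -/
noncomputable def diagonalHom {p : ℕ} (y : Fin p → X) :
    C(X, ℂ) →⋆ₐ[ℂ] Matrix (Fin p) (Fin p) ℂ where
  toFun f := Matrix.diagonal fun i => f (y i)
  map_one' := by simp
  map_mul' f g := by simp
  map_zero' := by simp
  map_add' f g := by simp
  commutes' c := by
    ext i j; simp [Matrix.algebraMap_eq_diagonal, Matrix.diagonal_apply]
  map_star' f := by
    rw [Matrix.star_eq_conjTranspose, Matrix.diagonal_conjTranspose]; rfl

/-- `f ↦ diag(f(y_0), …, f(y_{p-1}))` as operators. -/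
noncomputable def diagonalRho {p : ℕ} (y : Fin p → X) :
    C(X, ℂ) →⋆ₐ[ℂ] (PeriodicSpace p →L[ℂ] PeriodicSpace p) :=
  (StarAlgHomClass.toStarAlgHom (Matrix.toEuclideanCLM (n := Fin p) (𝕜 := ℂ))).comp (diagonalHom y)

theorem diagonalRho_apply {p : ℕ} (y : Fin p → X) (f : C(X, ℂ)) :
    diagonalRho y f
      = Matrix.toEuclideanCLM (n := Fin p) (𝕜 := ℂ) (Matrix.diagonal fun i => f (y i)) := rfl

/-- The operator `T_λ`. -/
noncomputable def periodicT (p : ℕ) (lam : Circle) :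
    unitary (PeriodicSpace p →L[ℂ] PeriodicSpace p) :=
  ⟨Matrix.toEuclideanCLM (n := Fin p) (𝕜 := ℂ) (twistMatrix p lam),
    Unitary.map_mem (Matrix.toEuclideanCLM (n := Fin p) (𝕜 := ℂ)) (twistMatrix_mem_unitary p lam)⟩

theorem norm_unitary_le {p : ℕ} (U : unitary (PeriodicSpace p →L[ℂ] PeriodicSpace p)) :
    ‖(U : PeriodicSpace p →L[ℂ] PeriodicSpace p)‖
      ≤ ‖(1 : PeriodicSpace p →L[ℂ] PeriodicSpace p)‖ := by
  have := CStarRing.norm_coe_unitary_mul U 1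
  rw [mul_one] at this
  exact this.le

theorem periodicT_mul_diagonalRho {p : ℕ} (lam : Circle) (y : Fin p → X) (f g : C(X, ℂ))
    (h : ∀ j, g (y (finRotate p j)) = f (y j)) :
    (periodicT p lam : PeriodicSpace p →L[ℂ] PeriodicSpace p) * diagonalRho y f
      = diagonalRho y g * (periodicT p lam : PeriodicSpace p →L[ℂ] PeriodicSpace p) := by
  have := congrArg (Matrix.toEuclideanCLM (n := Fin p) (𝕜 := ℂ))
    (twistMatrix_mul_diagonal p lam (fun i => f (y i)) (fun i => g (y i)) h)
  rw [map_mul, map_mul] at this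
  exact this

/-- The pair `(ρ_x, T_λ)`, with `ρ_x(f) = diag(f(x), f(σ x), …, f(σ^{p-1} x))` for `p` the period
of `x`. -/
noncomputable def periodicPair (σ : X ≃ₜ X) (x : X) (lam : Circle) :
    CovariantPair σ (PeriodicSpace (Function.minimalPeriod σ x) →L[ℂ]
      PeriodicSpace (Function.minimalPeriod σ x)) where
  ρ := (diagonalRho fun i : Fin (Function.minimalPeriod σ x) => σ^[(i : ℕ)] x).toAlgHom
  T := Unitary.toUnits (periodicT (Function.minimalPeriod σ x) lam)
  bound_ρ := ⟨1, fun f => by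
    rw [one_mul]; exact NonUnitalStarAlgHom.norm_apply_le (diagonalRho _) f⟩
  bound_T := ⟨_, fun n => by
    rw [← map_zpow, Unitary.val_toUnits_apply]; exact norm_unitary_le _⟩
  covariant := fun f => by
    rw [Units.eq_mul_inv_iff_mul_eq]
    refine (periodicT_mul_diagonalRho lam _ _ _ fun j => ?_).symm
    change f (σ.symm _) = f _
    exact congrArg f (iterate_finRotate σ.toEquiv x j)

/-- The finite dimensional representation `π_{x,λ}`. -/
noncomputable def periodicRep (σ : X ≃ₜ X) (x : X) (lam : Circle) :
    EllOne σ →ₐ[ℂ] (PeriodicSpace (Function.minimalPeriod σ x) →L[ℂ]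
      PeriodicSpace (Function.minimalPeriod σ x)) :=
  (periodicPair σ x lam).integrate

end Periodic

section Aperiodic

/-- The Banach space `ℓ¹(ℤ)`. -/
abbrev EllOneInt : Type := lp (fun _ : ℤ => ℂ) 1

theorem EllOneInt.summable_norm (v : EllOneInt) : Summable fun n => ‖v n‖ := by
  simpa using (lp.hasSum_norm (p := 1) (by simp) v).summable

theorem EllOneInt.norm_eq (v : EllOneInt) : ‖v‖ = ∑' n, ‖v n‖ := by
  simpa using lp.norm_eq_tsum_rpow (p := 1) (by simp) v

/-- Translation by `k`: `(S^k v)(n) = v (n - k)`, so that `S^k e_n = e_{n+k}`. -/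
noncomputable def shiftBy (k : ℤ) : EllOneInt →L[ℂ] EllOneInt :=
  LinearMap.mkContinuous
    { toFun := fun v => ⟨fun n => v (n - k), memℓp_gen (by
        simp only [ENNReal.toReal_one, Real.rpow_one]
        exact (Equiv.subRight k).summable_iff.2 v.summable_norm)⟩
      map_add' := fun _ _ => rfl
      map_smul' := fun _ _ => rfl }
    1 (fun v => by
      rw [one_mul, EllOneInt.norm_eq, EllOneInt.norm_eq]
      exact ((Equiv.subRight k).tsum_eq fun n => ‖v n‖).le)

@[simp] theorem shiftBy_apply (k : ℤ) (v : EllOneInt) (n : ℤ) :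
    shiftBy k v n = v (n - k) := rfl

/-- The right shift `S`. -/
noncomputable def rightShift : (EllOneInt →L[ℂ] EllOneInt)ˣ where
  val := shiftBy 1
  inv := shiftBy (-1)
  val_inv := by
    ext v n
    simp [mul_apply_eq_comp]
  inv_val := by
    ext v n
    simp [mul_apply_eq_comp]

theorem rightShift_zpow (k : ℤ) :
    ((rightShift ^ k : (EllOneInt →L[ℂ] EllOneInt)ˣ) : EllOneInt →L[ℂ] EllOneInt)
      = shiftBy k := by
  have hadd : ∀ a b : ℤ, shiftBy (a + b) = shiftBy a * shiftBy b := fun a b => by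
    ext v n
    simp [mul_apply_eq_comp, sub_sub]
  induction k with
  | zero => ext v n; simp
  | succ k ih => rw [zpow_add, zpow_one, Units.val_mul, ih, hadd]; rfl
  | pred k ih =>
    rw [sub_eq_add_neg, zpow_add, zpow_neg_one, Units.val_mul, ih, hadd]; rfl

variable {X : Type u} [TopologicalSpace X] [CompactSpace X]

/-- The diagonal operator `e_k ↦ f(σ^k x) e_k` on `ℓ¹(ℤ)`. -/
noncomputable def orbitMul (σ : X ≃ₜ X) (x : X) (f : C(X, ℂ)) : EllOneInt →L[ℂ] EllOneInt :=
  have key : ∀ (v : EllOneInt) (k : ℤ), ‖f ((σ ^ k : X ≃ₜ X) x) * v k‖ ≤ ‖f‖ * ‖v k‖ := fun v k =>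
    (norm_mul_le _ _).trans (mul_le_mul_of_nonneg_right (f.norm_coe_le_norm _) (norm_nonneg _))
  have hs : ∀ v : EllOneInt, Summable fun k : ℤ => ‖f ((σ ^ k : X ≃ₜ X) x) * v k‖ := fun v =>
    Summable.of_nonneg_of_le (fun _ => norm_nonneg _) (key v) (v.summable_norm.mul_left _)
  LinearMap.mkContinuous
    { toFun := fun v => ⟨fun k => f ((σ ^ k : X ≃ₜ X) x) * v k, memℓp_gen (by simpa using hs v)⟩
      map_add' := fun v w => by ext k; exact mul_add _ _ _
      map_smul' := fun c v => by ext k; exact mul_left_comm _ _ _ }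
    ‖f‖ (fun v => by
      rw [EllOneInt.norm_eq, EllOneInt.norm_eq, ← tsum_mul_left]
      exact (hs v).tsum_le_tsum (key v) (v.summable_norm.mul_left _))

@[simp] theorem orbitMul_apply (σ : X ≃ₜ X) (x : X) (f : C(X, ℂ)) (v : EllOneInt) (k : ℤ) :
    orbitMul σ x f v k = f ((σ ^ k : X ≃ₜ X) x) * v k := rfl

theorem norm_orbitMul_le (σ : X ≃ₜ X) (x : X) (f : C(X, ℂ)) : ‖orbitMul σ x f‖ ≤ ‖f‖ :=
  ContinuousLinearMap.opNorm_le_bound _ (norm_nonneg _) fun v => by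
    rw [EllOneInt.norm_eq, EllOneInt.norm_eq, ← tsum_mul_left]
    have key : ∀ k : ℤ, ‖orbitMul σ x f v k‖ ≤ ‖f‖ * ‖v k‖ := fun k =>
      (norm_mul_le _ _).trans (mul_le_mul_of_nonneg_right (f.norm_coe_le_norm _) (norm_nonneg _))
    exact (EllOneInt.summable_norm _).tsum_le_tsum key (v.summable_norm.mul_left _)

/-- The pair consisting of the diagonal operators and the right shift. -/
noncomputable def orbitPair (σ : X ≃ₜ X) (x : X) :
    CovariantPair σ (EllOneInt →L[ℂ] EllOneInt) where
  ρ := AlgHom.ofLinearMap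
    { toFun := orbitMul σ x
      map_add' := fun f g => by ext v k; exact add_mul _ _ _
      map_smul' := fun c f => by ext v k; exact mul_assoc _ _ _ }
    (by ext v k; exact one_mul _)
    (fun f g => by ext v k; exact mul_assoc _ _ _)
  T := rightShift
  bound_ρ := ⟨1, fun f => by rw [one_mul]; exact norm_orbitMul_le σ x f⟩
  bound_T := ⟨1, fun n => by
    rw [rightShift_zpow]; exact LinearMap.mkContinuous_norm_le _ zero_le_one _⟩
  covariant := fun f => by
    rw [Units.eq_mul_inv_iff_mul_eq]
    ext v k
    change f ((σ ^ (-1 : ℤ) : X ≃ₜ X) ((σ ^ k : X ≃ₜ X) x)) * v (k - 1)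
      = f ((σ ^ (k - 1) : X ≃ₜ X) x) * v (k - 1)
    rw [sub_eq_add_neg k 1, add_comm k, zpow_add]
    rfl

/-- The representation `π_x^1` on `ℓ¹(ℤ)`. -/
noncomputable def orbitRep (σ : X ≃ₜ X) (x : X) : EllOne σ →ₐ[ℂ] (EllOneInt →L[ℂ] EllOneInt) :=
  (orbitPair σ x).integrate

end Aperiodic

section StructureSets

variable {X : Type u} [TopologicalSpace X] [CompactSpace X]

/-- `Π_S`: the primitive ideals `Ker π_{x,λ}` (`x ∈ S` periodic, `λ ∈ 𝕋`) and `Ker π_x^1`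
(`x ∈ S` aperiodic), for an invariant set `S`. -/
def structureSet (σ : X ≃ₜ X) (S : Set X) : Set (StructureSpace (EllOne σ)) :=
  {P | (∃ x ∈ S, x ∈ Function.periodicPts σ ∧
          ∃ lam : Circle, P.ideal = TwoSidedIdeal.ker (periodicRep σ x lam)) ∨
       (∃ x ∈ S, x ∉ Function.periodicPts σ ∧ P.ideal = TwoSidedIdeal.ker (orbitRep σ x))}

/-- `Per_p(σ)`, the points of period exactly `p`, for `p ≥ 1`. -/
def perPoints (σ : X ≃ₜ X) (p : ℕ) : Set X := {x | Function.minimalPeriod σ x = p}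

/-- Two points of `S` are equivalent if they are in the same orbit of the `ℤ`-action. -/
def orbitSetoid (σ : X ≃ₜ X) (S : Set X) : Setoid S where
  r x y := ∃ n : ℤ, (σ ^ n : X ≃ₜ X) (x : X) = y
  iseqv :=
    { refl := fun x => ⟨0, rfl⟩
      symm := by
        rintro x y ⟨n, h⟩
        exact ⟨-n, by rw [← h, zpow_neg]; exact (σ ^ n).symm_apply_apply _⟩
      trans := by
        rintro x y z ⟨n, h⟩ ⟨m, h'⟩
        exact ⟨m + n, by rw [← h', ← h, zpow_add]; rfl⟩ }

/-- The orbit space `S/ℤ`, with the quotient topology of the subspace topology of `S`. -/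
abbrev OrbitSpace (σ : X ≃ₜ X) (S : Set X) : Type u := Quotient (orbitSetoid σ S)

end StructureSets

/-! ### Coefficients of products with one-term elements -/

namespace EllOne

variable {X : Type u} [TopologicalSpace X] [CompactSpace X] {σ : X ≃ₜ X}

/-! Compactness of `Π_X` follows once every proper two-sided ideal `I` lies in a member of `Π_X`
(`exists_mem_structureSet_ge`): for closed sets with the finite intersection property relative to
`Π_X`, the kernels of the finite intersections form a directed family of proper ideals. Their union
is proper, and a member of `Π_X` containing it lies in all the closed sets. To find that member,
note that the functions in `I` have a common zero `x`. The analytic core is `not_restrict_eq_one`: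
no `a ∈ I` restricts to the identity on the isotropy of `x`. Otherwise, for a bump `g` concentrated
near `x`, the compression `g a g` is so close in norm to `g²` that a Neumann series puts a function
with value `1` at `x` into `I`. If `x` is aperiodic, translating elements of `I` shows that all
their coefficients vanish along the orbit, so `I ≤ Ker π_x^1`. If `x` has period `p`, restriction to
the isotropy group `pℤ` gives a proper ideal of `ℓ¹(ℤ)`. It lies in the kernel of a character, that
is, of evaluation at some `λ ∈ 𝕋`, and then `I ≤ Ker π_{x,λ}`. For the description of `Π_S`, the
matrix coefficients of `π_{x,λ}(a)` are, up to powers of `λ`, the sums `∑_m a(pm + k)(σ^i x) λ^m`.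
These are continuous in `(x, λ)` while the period stays constant, which makes `Ψ` continuous.
Injectivity and closedness come from one separation statement (`exists_mem_ideal_of_notMem`): a
function of the orbit, extended from `S` to `X` by Tietze, times a function on the circle with
absolutely summable Fourier coefficients and small support, is realised by an element of the
algebra. On a finite union of the `S_i` the period is locally constant, so the argument applies to
`S` and to each `S_i`. The disjoint union statement is then a continuous bijection from a compact
space to a Hausdorff space. -/

theorem single_mul_apply (i : ℤ) (f : C(X, ℂ)) (a : EllOne σ) (n : ℤ) :
    (single σ i f * a) n = f * alphaPow σ i (a (n - i)) := by
  rw [mul_apply, tsum_eq_single i]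
  · simp [single_apply]
  · intro k hk
    simp [single_apply, hk]

theorem mul_single_apply (a : EllOne σ) (j : ℤ) (g : C(X, ℂ)) (n : ℤ) :
    (a * single σ j g) n = a (n - j) * alphaPow σ (n - j) g := by
  rw [mul_apply, tsum_eq_single (n - j)]
  · simp [single_apply]
  · intro k hk
    rw [single_apply, if_neg (fun h => hk (by omega))]
    ext x; simp [alphaPow]

theorem alphaPow_apply (k : ℤ) (f : C(X, ℂ)) (x : X) :
    alphaPow σ k f x = f ((σ ^ (-k) : X ≃ₜ X) x) := rfl

theorem norm_apply_apply_le (a : EllOne σ) (n : ℤ) (x : X) : ‖a n x‖ ≤ ‖a n‖ :=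
  (a n).norm_coe_le_norm x

end EllOne

/-! ### Integer powers of `σ`, isotropy and periods -/

section HomeoPowers

variable {X : Type u} [TopologicalSpace X] (σ : X ≃ₜ X)

theorem homeo_zpow_add_apply (i j : ℤ) (x : X) :
    (σ ^ (i + j) : X ≃ₜ X) x = (σ ^ i : X ≃ₜ X) ((σ ^ j : X ≃ₜ X) x) := by
  rw [zpow_add]; rfl

theorem homeo_zpow_natCast_apply (n : ℕ) (x : X) : (σ ^ (n : ℤ) : X ≃ₜ X) x = σ^[n] x := by
  induction n with
  | zero => simp
  | succ n ih =>
    rw [Nat.cast_succ, add_comm, homeo_zpow_add_apply, ih, zpow_one, Function.iterate_succ_apply']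

theorem homeo_zpow_neg_apply_eq_iff (n : ℤ) (x y : X) :
    (σ ^ (-n) : X ≃ₜ X) x = y ↔ x = (σ ^ n : X ≃ₜ X) y := by
  rw [zpow_neg]
  exact (σ ^ n : X ≃ₜ X).toEquiv.symm_apply_eq

theorem homeo_zpow_mul_apply_of_fixed {p : ℤ} {x : X} (h : (σ ^ p : X ≃ₜ X) x = x) (m : ℤ) :
    (σ ^ (p * m) : X ≃ₜ X) x = x := by
  have hneg : (σ ^ (-p) : X ≃ₜ X) x = x := (homeo_zpow_neg_apply_eq_iff σ p x x).2 h.symm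
  induction m with
  | zero => simp
  | succ m ih => rw [mul_add, mul_one, homeo_zpow_add_apply, h, ih]
  | pred m ih => rw [mul_sub, mul_one, sub_eq_add_neg, homeo_zpow_add_apply, hneg, ih]

theorem homeo_zpow_minimalPeriod_mul_apply (x : X) (m : ℤ) :
    (σ ^ ((Function.minimalPeriod σ x : ℤ) * m) : X ≃ₜ X) x = x := by
  refine homeo_zpow_mul_apply_of_fixed σ ?_ m
  rw [homeo_zpow_natCast_apply]
  exact Function.iterate_minimalPeriod

/-- The value `0` of `minimalPeriod` at an aperiodic point makes this cover that case too: the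
isotropy group is then trivial. -/
theorem homeo_zpow_fixed_iff (x : X) (n : ℤ) :
    (σ ^ n : X ≃ₜ X) x = x ↔ (Function.minimalPeriod σ x : ℤ) ∣ n := by
  constructor
  · intro h
    rw [← Int.dvd_natAbs, Int.natCast_dvd_natCast]
    refine Function.IsPeriodicPt.minimalPeriod_dvd ?_
    change σ^[n.natAbs] x = x
    rw [← homeo_zpow_natCast_apply]
    rcases Int.natAbs_eq n with h' | h'
    · rwa [← h']
    · rw [h', homeo_zpow_neg_apply_eq_iff] at h
      exact h.symm
  · rintro ⟨m, rfl⟩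
    exact homeo_zpow_minimalPeriod_mul_apply σ x m

theorem homeo_zpow_emod_apply (x : X) (n : ℤ) :
    (σ ^ (n % (Function.minimalPeriod σ x : ℤ)) : X ≃ₜ X) x = (σ ^ n : X ≃ₜ X) x := by
  conv_rhs => rw [← Int.emod_add_mul_ediv n (Function.minimalPeriod σ x : ℤ),
    homeo_zpow_add_apply, homeo_zpow_minimalPeriod_mul_apply]

/-- Powers of `σ` commute, so all points of an orbit have the same isotropy group, and the period is
its non-negative generator. -/
theorem minimalPeriod_homeo_zpow_apply (x : X) (n : ℤ) :
    Function.minimalPeriod σ ((σ ^ n : X ≃ₜ X) x) = Function.minimalPeriod σ x := by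
  have key : ∀ m : ℤ, (σ ^ m : X ≃ₜ X) ((σ ^ n : X ≃ₜ X) x) = (σ ^ n : X ≃ₜ X) x
      ↔ (σ ^ m : X ≃ₜ X) x = x := fun m => by
    rw [← homeo_zpow_add_apply, add_comm, homeo_zpow_add_apply]
    exact (σ ^ n : X ≃ₜ X).injective.eq_iff
  apply Nat.dvd_antisymm
  · rw [← Int.natCast_dvd_natCast, ← homeo_zpow_fixed_iff, key, homeo_zpow_fixed_iff]
  · rw [← Int.natCast_dvd_natCast, ← homeo_zpow_fixed_iff, ← key, homeo_zpow_fixed_iff]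

end HomeoPowers

/-! ### Matrix coefficients and kernels of the representations at periodic points -/

section PeriodicKernel

variable {X : Type u} [TopologicalSpace X] [CompactSpace X] {σ : X ≃ₜ X}

/-- `∑_m a(pm + k)(σ^i x) λ^m`; for `p` the period of `x` these are, up to powers of `λ`, the matrix
coefficients of `π_{x,λ}(a)`. -/
noncomputable def fiberSeries (p : ℕ) (i k : ℤ) (a : EllOne σ) (x : X) (lam : Circle) : ℂ :=
  ∑' m : ℤ, a (p * m + k) ((σ ^ i : X ≃ₜ X) x) * (lam : ℂ) ^ m

/-- The vector `T_λ^j e_0`. -/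
noncomputable def periodicVec (p : ℕ) (lam : Circle) (j : ℤ) : PeriodicSpace p :=
  WithLp.toLp 2 fun r => if (p : ℤ) ∣ j - (r : ℕ) then (lam : ℂ) ^ ((j - (r : ℕ)) / (p : ℤ)) else 0

theorem periodicT_periodicVec (p : ℕ) (lam : Circle) (j : ℤ) :
    (periodicT p lam : PeriodicSpace p →L[ℂ] PeriodicSpace p) (periodicVec p lam j)
      = periodicVec p lam (j + 1) := by
  obtain _ | p := p
  · ext r; exact r.elim0
  ext r
  change (Matrix.mulVec (twistMatrix (p + 1) lam) (periodicVec (p + 1) lam j).ofLp) r = _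
  obtain ⟨s, rfl⟩ := (finRotate (p + 1)).surjective r
  rw [Matrix.mulVec, dotProduct, Finset.sum_eq_single s]
  · rw [twistMatrix_apply, if_pos rfl]
    rcases eq_or_ne s (Fin.last p) with rfl | hs
    -- Wrap-around, the period being `p + 1` here: the factor `λ` is absorbed by the exponent, which
    -- rises by one because `j - p = (j + 1) - (p + 1)`.
    · have h1 : j - (p : ℤ) = j + 1 - ((p + 1 : ℕ) : ℤ) := by push_cast; ring
      have hp : ((p + 1 : ℕ) : ℤ) ≠ 0 := by positivity
      simp only [periodicVec, Fin.val_last, finRotate_last, Fin.val_zero, Nat.cast_zero, sub_zero,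
        if_true, h1, dvd_sub_self_right]
      split_ifs with hd
      · rw [Int.sub_ediv_of_dvd _ dvd_rfl, Int.ediv_self hp,
          ← zpow_one_add₀ (Circle.coe_ne_zero lam)]
        congr 1; ring
      · rw [mul_zero]
    · have hlt : (s : ℕ) ≠ p := fun h => hs (Fin.ext h)
      have h2 : (finRotate (p + 1) s : ℕ) = s + 1 := coe_finRotate_of_ne_last hs
      have h3 : j + 1 - ((s + 1 : ℕ) : ℤ) = j - (s : ℕ) := by push_cast; ring
      rw [if_neg (by omega), one_mul]
      simp only [periodicVec, h2, h3]
  · intro t _ ht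
    rw [twistMatrix_apply, if_neg (fun h => ht ((finRotate (p + 1)).injective h).symm), zero_mul]
  · simp

theorem periodicPair_T_zpow_apply (x : X) (lam : Circle) (n j : ℤ) :
    (((periodicPair σ x lam).T ^ n : (PeriodicSpace (Function.minimalPeriod σ x) →L[ℂ]
      PeriodicSpace (Function.minimalPeriod σ x))ˣ) : PeriodicSpace (Function.minimalPeriod σ x)
        →L[ℂ] PeriodicSpace (Function.minimalPeriod σ x)) (periodicVec _ lam j)
      = periodicVec _ lam (n + j) := by
  set T := (periodicPair σ x lam).T with hT
  have h1 : ∀ j, (T : PeriodicSpace (Function.minimalPeriod σ x) →L[ℂ]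
      PeriodicSpace (Function.minimalPeriod σ x)) (periodicVec _ lam j)
        = periodicVec _ lam (j + 1) := fun j => periodicT_periodicVec _ lam j
  have h2 : ∀ j, ((T⁻¹ : (PeriodicSpace (Function.minimalPeriod σ x) →L[ℂ]
      PeriodicSpace (Function.minimalPeriod σ x))ˣ) : PeriodicSpace (Function.minimalPeriod σ x)
        →L[ℂ] PeriodicSpace (Function.minimalPeriod σ x)) (periodicVec _ lam j)
        = periodicVec _ lam (j - 1) := fun j => by
    have h := h1 (j - 1)
    rw [sub_add_cancel] at h
    rw [← h, ← mul_apply_eq_comp, Units.inv_mul]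
    rfl
  induction n generalizing j with
  | zero => simp
  | succ n ih =>
    rw [zpow_add, zpow_one, Units.val_mul, mul_apply_eq_comp, h1, ih]
    congr 1; ring
  | pred n ih =>
    rw [sub_eq_add_neg, zpow_add, zpow_neg_one, Units.val_mul, mul_apply_eq_comp, h2,
      ih]
    congr 1; ring

theorem periodicPair_ρ_apply (x : X) (lam : Circle) (f : C(X, ℂ))
    (v : PeriodicSpace (Function.minimalPeriod σ x)) (r : Fin (Function.minimalPeriod σ x)) :
    (periodicPair σ x lam).ρ f v r = f ((σ ^ ((r : ℕ) : ℤ) : X ≃ₜ X) x) * v r := by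
  rw [homeo_zpow_natCast_apply]
  change (Matrix.mulVec (Matrix.diagonal _) v.ofLp) r = _
  rw [Matrix.mulVec_diagonal]

theorem periodicRep_apply_periodicVec (a : EllOne σ) {x : X} (hx : x ∈ Function.periodicPts σ)
    (lam : Circle) (j : ℤ) (r : Fin (Function.minimalPeriod σ x)) :
    periodicRep σ x lam a (periodicVec _ lam j) r
      = fiberSeries (Function.minimalPeriod σ x) (r : ℕ) ((r : ℕ) - j) a x lam := by
  have hp : 0 < Function.minimalPeriod σ x := Function.minimalPeriod_pos_of_mem_periodicPts hx
  have hp' : (Function.minimalPeriod σ x : ℤ) ≠ 0 := by positivity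
  let ev : (PeriodicSpace (Function.minimalPeriod σ x) →L[ℂ]
      PeriodicSpace (Function.minimalPeriod σ x)) →L[ℂ] ℂ :=
    (EuclideanSpace.proj r).comp (ContinuousLinearMap.apply ℂ _ (periodicVec _ lam j))
  have h1 : periodicRep σ x lam a (periodicVec _ lam j) r
      = ∑' n : ℤ, a n ((σ ^ ((r : ℕ) : ℤ) : X ≃ₜ X) x) * periodicVec _ lam (n + j) r := by
    change ev ((periodicPair σ x lam).integrate a) = _
    rw [CovariantPair.integrate_apply, ev.map_tsum ((periodicPair σ x lam).summable a)]
    refine tsum_congr fun n => ?_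
    change (((periodicPair σ x lam).ρ (a n) * _) (periodicVec _ lam j)) r = _
    rw [mul_apply_eq_comp, periodicPair_ρ_apply, periodicPair_T_zpow_apply]
  rw [h1, fiberSeries]
  have hinj : Function.Injective fun m : ℤ => (Function.minimalPeriod σ x : ℤ) * m + ((r : ℕ) - j) := fun m n h => by
    simpa [hp.ne'] using h
  -- The `r`-th coordinate of `T_λ^{n+j} e_0` vanishes unless `p` divides `n + j - r`, so only the
  -- indices `n = pm + (r - j)` contribute.
  rw [← hinj.tsum_eq]
  · refine tsum_congr fun m => ?_
    have h2 : (Function.minimalPeriod σ x : ℤ) * m + ((r : ℕ) - j) + j - (r : ℕ) 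
        = (Function.minimalPeriod σ x : ℤ) * m := by ring
    simp only [periodicVec, h2, dvd_mul_right, if_true, Int.mul_ediv_cancel_left _ hp']
  · intro n hn
    have hd : (Function.minimalPeriod σ x : ℤ) ∣ n + j - (r : ℕ) := by
      by_contra hd
      exact hn (by simp only [periodicVec, hd, if_false, mul_zero])
    obtain ⟨m, hm⟩ := hd
    exact ⟨m, by simp only; omega⟩

theorem fiberSeries_add_mul (p : ℕ) (i k t : ℤ) (a : EllOne σ) (x : X) (lam : Circle) :
    fiberSeries p i (k + p * t) a x lam = (lam : ℂ) ^ (-t) * fiberSeries p i k a x lam := by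
  rw [fiberSeries, fiberSeries, ← tsum_mul_left, ← (Equiv.subRight t).tsum_eq]
  refine tsum_congr fun m => ?_
  rw [Equiv.subRight_apply, zpow_sub₀ (Circle.coe_ne_zero lam), zpow_neg]
  have : (p : ℤ) * (m - t) + (k + p * t) = p * m + k := by ring
  rw [this]; ring

theorem fiberSeries_emod (i k : ℤ) (a : EllOne σ) (x : X) (lam : Circle) :
    fiberSeries (Function.minimalPeriod σ x) (i % (Function.minimalPeriod σ x : ℤ)) k a x lam
      = fiberSeries (Function.minimalPeriod σ x) i k a x lam := by
  simp only [fiberSeries, homeo_zpow_emod_apply]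

/-- The vectors `T_λ^j e_0`, `0 ≤ j < p`, are the standard basis. -/
theorem periodicVec_eq_single (p : ℕ) (lam : Circle) (s : Fin p) :
    periodicVec p lam (s : ℕ) = EuclideanSpace.single s 1 := by
  ext r
  have hr := r.2
  have hs := s.2
  rcases eq_or_ne r s with rfl | h
  · simp [periodicVec]
  · have h' : (s : ℤ) - (r : ℕ) ≠ 0 := fun h0 => h (Fin.ext (by omega))
    have hd : ¬ (p : ℤ) ∣ ((s : ℕ) : ℤ) - (r : ℕ) := fun hd => by
      have := Int.eq_zero_of_abs_lt_dvd hd (by rw [abs_lt]; constructor <;> omega)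
      exact h' this
    simp [periodicVec, hd, h]

/-- The fibre series are matrix coefficients of `π_{x,λ}(a)` up to powers of `λ`. Letting `i` and
`k` range over all of `ℤ` makes the criterion invariant under moving `x` along its orbit. Continuity
of `Ψ` and separation of points both rest on it. -/
theorem mem_ker_periodicRep_iff (a : EllOne σ) {x : X} (hx : x ∈ Function.periodicPts σ)
    (lam : Circle) : a ∈ TwoSidedIdeal.ker (periodicRep σ x lam) ↔
      ∀ i k : ℤ, fiberSeries (Function.minimalPeriod σ x) i k a x lam = 0 := by
  have hp : 0 < Function.minimalPeriod σ x := Function.minimalPeriod_pos_of_mem_periodicPts hx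
  have hp' : (0 : ℤ) < Function.minimalPeriod σ x := by positivity
  rw [TwoSidedIdeal.mem_ker]
  constructor
  · intro h i k
    rw [← fiberSeries_emod]
    have h0 := Int.emod_nonneg i hp'.ne'
    have h1 := Int.emod_lt_of_pos i hp'
    -- Row `i mod p` and the vector `T_λ^j e_0` with `j = (i mod p) - k` produce exactly the series
    -- with parameters `i mod p` and `k`.
    have key := periodicRep_apply_periodicVec a hx lam
      (i % (Function.minimalPeriod σ x : ℤ) - k)
      ⟨(i % (Function.minimalPeriod σ x : ℤ)).toNat, by omega⟩
    rw [h] at key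
    simp only [Int.toNat_of_nonneg h0, sub_sub_cancel] at key
    exact key.symm
  · intro h
    ext v r
    have hv : v = ∑ s, v s • periodicVec (Function.minimalPeriod σ x) lam (s : ℕ) := by
      simp only [periodicVec_eq_single]
      ext r
      simp [Pi.single_apply]
    rw [hv, map_sum]
    simp only [map_smul, WithLp.ofLp_sum, WithLp.ofLp_smul, Finset.sum_apply, Pi.smul_apply]
    refine Finset.sum_eq_zero fun s _ => ?_
    rw [periodicRep_apply_periodicVec a hx, h, smul_zero]

/-- `Ker π_{x,λ}` depends only on the orbit of `x`. -/
theorem ker_periodicRep_zpow (x : X) (hx : x ∈ Function.periodicPts σ) (n : ℤ) (lam : Circle) :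
    TwoSidedIdeal.ker (periodicRep σ ((σ ^ n : X ≃ₜ X) x) lam)
      = TwoSidedIdeal.ker (periodicRep σ x lam) := by
  have hx' : (σ ^ n : X ≃ₜ X) x ∈ Function.periodicPts σ := by
    rw [← Function.minimalPeriod_pos_iff_mem_periodicPts, minimalPeriod_homeo_zpow_apply]
    exact Function.minimalPeriod_pos_of_mem_periodicPts hx
  ext a
  rw [mem_ker_periodicRep_iff a hx, mem_ker_periodicRep_iff a hx', minimalPeriod_homeo_zpow_apply]
  have h : ∀ i k, fiberSeries (Function.minimalPeriod σ x) i k a ((σ ^ n : X ≃ₜ X) x) lam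
      = fiberSeries (Function.minimalPeriod σ x) (i + n) k a x lam := fun i k => by
    simp only [fiberSeries, homeo_zpow_add_apply]
  simp only [h]
  exact ⟨fun H i k => by simpa using H (i - n) k, fun H i k => H _ _⟩

end PeriodicKernel

/-! ### Algebraic irreducibility of the representations -/

section Primitivity

/-- The kernel of a representation for which every non-zero vector generates the whole space in the
algebraic sense is a primitive ideal. -/
theorem isPrimitiveIdeal_ker_of_transitive {A : Type u} [Ring A] [Algebra ℂ A] {E : Type}
    [NormedAddCommGroup E] [NormedSpace ℂ E] [Nontrivial E] (π : A →ₐ[ℂ] (E →L[ℂ] E))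
    (h : ∀ v, v ≠ 0 → ∀ w, ∃ a, π a v = w) : IsPrimitiveIdeal (TwoSidedIdeal.ker π) := by
  -- Primitive ideals are defined by modules in the universe of `A`, so `E` is lifted there.
  let e : ULift.{u} E ≃ₗ[ℂ] E := ULift.moduleEquiv
  let φ : A →ₙₐ[ℂ] Module.End ℂ (ULift.{u} E) :=
    { toFun := fun a => e.symm.conj (π a : E →ₗ[ℂ] E)
      map_smul' := fun c a => by ext v; simp [LinearEquiv.conj_apply]
      map_zero' := by ext v; simp [LinearEquiv.conj_apply]
      map_add' := fun a b => by ext v; simp [LinearEquiv.conj_apply]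
      map_mul' := fun a b => by ext v; simp [LinearEquiv.conj_apply] }
  have hφ : ∀ a v, φ a v = e.symm (π a (e v)) := fun a v => rfl
  refine ⟨ULift.{u} E, inferInstance, inferInstance, φ, ⟨?_, ?_⟩, ?_⟩
  · obtain ⟨v, hv⟩ := exists_ne (0 : E)
    refine ⟨1, e.symm v, ?_⟩
    rw [hφ, map_one]
    simpa using hv
  · intro W hW
    refine or_iff_not_imp_left.2 fun hne => ?_
    obtain ⟨v, hvW, hv⟩ := W.ne_bot_iff.1 hne
    refine Submodule.eq_top_iff'.2 fun w => ?_
    obtain ⟨a, ha⟩ := h (e v) (by simpa using hv) (e w)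
    have := hW a v hvW
    rwa [hφ, ha, e.symm_apply_apply] at this
  · ext a
    rw [TwoSidedIdeal.mem_ker, TwoSidedIdeal.mem_ker]
    constructor
    · intro ha
      ext v
      rw [hφ, ha]; rfl
    · intro ha
      ext v
      have := LinearMap.congr_fun ha (e.symm v)
      rw [hφ, e.apply_symm_apply] at this
      simpa using this

variable {X : Type u} [TopologicalSpace X] [CompactSpace X] {σ : X ≃ₜ X}

theorem CovariantPair.integrate_single {B : Type*} [NormedRing B] [NormedAlgebra ℂ B]
    [CompleteSpace B] (V : CovariantPair σ B) (n : ℤ) (f : C(X, ℂ)) :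
    V.integrate (EllOne.single σ n f) = V.ρ f * ((V.T ^ n : Bˣ) : B) :=
  V.toCLM_single n f

/-- A continuous function that is `1` at a point, `0` on a finite set not containing it, and has
norm at most `1`. -/
theorem exists_continuous_eq_one_eq_zero_finite [T2Space X] (x : X) (F : Set X) (hF : F.Finite)
    (hx : x ∉ F) : ∃ f : C(X, ℂ), f x = 1 ∧ (∀ y ∈ F, f y = 0) ∧ ∀ y, ‖f y‖ ≤ 1 := by
  obtain ⟨f, hf0, hf1, hf⟩ := exists_continuous_zero_one_of_isClosed hF.isClosed
    (isClosed_singleton (x := x)) (disjoint_singleton_right.2 hx)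
  refine ⟨⟨fun y => (f y : ℂ), by fun_prop⟩, ?_, fun y hy => ?_, fun y => ?_⟩
  · simp [hf1 rfl]
  · simp [hf0 hy]
  · have := hf y
    simpa [abs_of_nonneg this.1] using this.2

/-- A bump function separating one point of the finite orbit from the others isolates a non-zero
coordinate of `v`; powers of `T_λ` then carry that basis vector to all the others. -/
theorem periodicRep_transitive [T2Space X] {x : X} (lam : Circle)
    (v : PeriodicSpace (Function.minimalPeriod σ x)) (hv : v ≠ 0)
    (w : PeriodicSpace (Function.minimalPeriod σ x)) : ∃ a, periodicRep σ x lam a v = w := by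
  obtain ⟨s, hs⟩ : ∃ s, v s ≠ 0 := by
    by_contra! h
    exact hv (by ext s; exact h s)
  obtain ⟨f, hf1, hf0, -⟩ := exists_continuous_eq_one_eq_zero_finite (σ^[(s : ℕ)] x)
    ((fun r : Fin (Function.minimalPeriod σ x) => σ^[(r : ℕ)] x) '' {s}ᶜ) (Set.toFinite _) (by
      rintro ⟨r, hr, h⟩
      exact hr (Fin.ext (Function.iterate_injOn_Iio_minimalPeriod r.2 s.2 h)))
  have h1 : periodicRep σ x lam (EllOne.single σ 0 f) v = v s • periodicVec _ lam (s : ℕ) := by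
    rw [periodicRep, CovariantPair.integrate_single, zpow_zero, Units.val_one, mul_one,
      periodicVec_eq_single]
    ext r
    rw [periodicPair_ρ_apply, homeo_zpow_natCast_apply]
    rcases eq_or_ne r s with rfl | hr
    · simp [hf1]
    · simp [hf0 _ ⟨r, hr, rfl⟩, hr]
  refine ⟨(∑ r, (w r * (v s)⁻¹) • EllOne.single σ ((r : ℕ) - (s : ℕ)) 1) * EllOne.single σ 0 f, ?_⟩
  rw [map_mul, mul_apply_eq_comp, h1, map_sum, sum_apply]
  have h2 : ∀ r : Fin (Function.minimalPeriod σ x),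
      periodicRep σ x lam ((w r * (v s)⁻¹) • EllOne.single σ ((r : ℕ) - (s : ℕ)) 1)
        (v s • periodicVec _ lam (s : ℕ)) = w r • EuclideanSpace.single r 1 := fun r => by
    rw [map_smul (periodicRep σ x lam), smul_apply, periodicRep, CovariantPair.integrate_single,
      map_one, one_mul, map_smul, periodicPair_T_zpow_apply, sub_add_cancel,
      periodicVec_eq_single, smul_smul, inv_mul_cancel_right₀ hs]
  simp only [h2]
  ext r
  simp [Pi.single_apply]

theorem isPrimitiveIdeal_ker_periodicRep [T2Space X] {x : X} (hx : x ∈ Function.periodicPts σ)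
    (lam : Circle) : IsPrimitiveIdeal (TwoSidedIdeal.ker (periodicRep σ x lam)) := by
  have : Nonempty (Fin (Function.minimalPeriod σ x)) :=
    ⟨⟨0, Function.minimalPeriod_pos_of_mem_periodicPts hx⟩⟩
  exact isPrimitiveIdeal_ker_of_transitive _ (periodicRep_transitive lam)

theorem norm_orbitRep_le (x : X) (a : EllOne σ) : ‖orbitRep σ x a‖ ≤ ‖a‖ := by
  rw [orbitRep, CovariantPair.integrate_apply, EllOne.norm_eq]
  refine tsum_of_norm_bounded (EllOne.summable_norm a).hasSum fun n => ?_
  refine (norm_mul_le _ _).trans ?_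
  have h1 : ‖(orbitPair σ x).ρ (a n)‖ ≤ ‖a n‖ := norm_orbitMul_le σ x (a n)
  have h2 : ‖(((orbitPair σ x).T ^ n : (EllOneInt →L[ℂ] EllOneInt)ˣ) : EllOneInt →L[ℂ] EllOneInt)‖
      ≤ 1 := by
    change ‖((rightShift ^ n : (EllOneInt →L[ℂ] EllOneInt)ˣ) : EllOneInt →L[ℂ] EllOneInt)‖ ≤ 1
    rw [rightShift_zpow]
    exact LinearMap.mkContinuous_norm_le _ zero_le_one _
  simpa using mul_le_mul h1 h2 (norm_nonneg _) (norm_nonneg _)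

theorem orbitRep_apply_apply (x : X) (a : EllOne σ) (v : EllOneInt) (k : ℤ) :
    orbitRep σ x a v k = ∑' n : ℤ, a n ((σ ^ k : X ≃ₜ X) x) * v (k - n) := by
  let ev : (EllOneInt →L[ℂ] EllOneInt) →L[ℂ] ℂ :=
    (lp.evalCLM ℂ (fun _ : ℤ => ℂ) 1 k).comp (ContinuousLinearMap.apply ℂ _ v)
  change ev ((orbitPair σ x).integrate a) = _
  rw [CovariantPair.integrate_apply, ev.map_tsum ((orbitPair σ x).summable a)]
  refine tsum_congr fun n => ?_
  change orbitMul σ x (a n)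
    (((rightShift ^ n : (EllOneInt →L[ℂ] EllOneInt)ˣ) : EllOneInt →L[ℂ] EllOneInt) v) k = _
  rw [rightShift_zpow, orbitMul_apply, shiftBy_apply]

/-- The element of the algebra with given constant coefficients. -/
noncomputable def constElement (σ : X ≃ₜ X) (c : ℤ → ℂ) (hc : Summable fun n => ‖c n‖) : EllOne σ :=
  EllOne.mk (fun n => ContinuousMap.const X (c n)) (Summable.of_nonneg_of_le
    (fun _ => norm_nonneg _)
    (fun _ => (ContinuousMap.norm_le _ (norm_nonneg _)).2 fun _ => le_rfl) hc)

theorem constElement_apply (c : ℤ → ℂ) (hc : Summable fun n => ‖c n‖) (n : ℤ) (x : X) :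
    constElement σ c hc n x = c n := rfl

theorem norm_constElement_le (c : ℤ → ℂ) (hc : Summable fun n => ‖c n‖) :
    ‖constElement σ c hc‖ ≤ ∑' n, ‖c n‖ := by
  rw [EllOne.norm_eq]
  exact (EllOne.summable_norm _).tsum_le_tsum
    (fun _ => (ContinuousMap.norm_le _ (norm_nonneg _)).2 fun _ => le_rfl) hc

theorem orbitRep_constElement_single (x : X) (w : EllOneInt) :
    orbitRep σ x (constElement σ w w.summable_norm) (lp.single 1 (0 : ℤ) (1 : ℂ)) = w := by
  ext k
  rw [orbitRep_apply_apply, tsum_eq_single k]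
  · simp [constElement_apply]
  · intro n hn
    have : k - n ≠ 0 := sub_ne_zero.2 hn.symm
    simp [lp.single_apply, this]

/-- A vector close to `e_0` generates `ℓ¹(ℤ)` under `π_x^1`. -/
theorem orbitRep_transitive_of_near (x : X) (v : EllOneInt)
    (hv : ‖v - lp.single 1 (0 : ℤ) (1 : ℂ)‖ < 1) (w : EllOneInt) :
    ∃ a, orbitRep σ x a v = w := by
  set r := v - lp.single 1 (0 : ℤ) (1 : ℂ) with hr
  let K : EllOneInt →L[ℂ] EllOneInt := LinearMap.mkContinuous
    { toFun := fun u => orbitRep σ x (constElement σ u u.summable_norm) r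
      map_add' := fun u u' => by
        rw [← add_apply, ← map_add]; rfl
      map_smul' := fun c u => by
        rw [RingHom.id_apply, ← smul_apply, ← map_smul]; rfl }
    ‖r‖ (fun u => by
      refine (ContinuousLinearMap.le_opNorm _ _).trans ?_
      rw [mul_comm]
      refine mul_le_mul_of_nonneg_left ((norm_orbitRep_le x _).trans ?_) (norm_nonneg _)
      rw [EllOneInt.norm_eq u]
      exact norm_constElement_le _ _)
  have hK : ‖-K‖ < 1 := by
    rw [norm_neg]
    exact (LinearMap.mkContinuous_norm_le _ (norm_nonneg _) _).trans_lt hv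
  -- The constant-coefficient element with coefficients `u` sends `e_0` to `u`, hence `v = e_0 + r`
  -- to `u + K u`. Since `‖K‖ ≤ ‖r‖ < 1`, the operator `1 + K` is invertible and `u + K u = w` is
  -- solvable.
  set U := Units.oneSub (-K) hK with hU
  set u := (↑U⁻¹ : EllOneInt →L[ℂ] EllOneInt) w with hu
  refine ⟨constElement σ u u.summable_norm, ?_⟩
  have h1 : (U : EllOneInt →L[ℂ] EllOneInt) u = w := by
    rw [hu, ← mul_apply_eq_comp, Units.mul_inv]; rfl
  have h2 : (U : EllOneInt →L[ℂ] EllOneInt) u = u + K u := by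
    rw [hU, Units.val_oneSub, sub_neg_eq_add]; rfl
  have h3 : v = lp.single 1 (0 : ℤ) (1 : ℂ) + r := by rw [hr]; abel
  rw [h3, map_add, orbitRep_constElement_single, ← h1, h2]
  rfl

/-- Pick `k` with `v k ≠ 0`. A bump function at `σ^k x`, zero at the other orbit points with index
in a large finite set, suppresses all but the `k`-th coordinate and a small tail. Shifting and
rescaling bring the result close to `e_0`, where the Neumann series applies. Aperiodicity makes the
orbit points distinct. -/
theorem orbitRep_transitive [T2Space X] {x : X} (hx : x ∉ Function.periodicPts σ)
    (v : EllOneInt) (hv : v ≠ 0) (w : EllOneInt) : ∃ a, orbitRep σ x a v = w := by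
  obtain ⟨k, hk⟩ : ∃ k, v k ≠ 0 := by
    by_contra! h
    exact hv (by ext k; exact h k)
  have hinj : ∀ i j : ℤ, (σ ^ i : X ≃ₜ X) x = (σ ^ j : X ≃ₜ X) x → i = j := fun i j h => by
    have h0 : (σ ^ (i - j) : X ≃ₜ X) x = x := by
      rw [sub_eq_add_neg, add_comm, homeo_zpow_add_apply, h, ← homeo_zpow_add_apply]
      simp
    rw [homeo_zpow_fixed_iff, Function.minimalPeriod_eq_zero_of_notMem_periodicPts hx] at h0
    simpa [sub_eq_zero] using h0
  -- The tail has to stay below `‖v k‖` because the vector is divided by `v k` afterwards.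
  obtain ⟨F, hF⟩ : ∃ F : Finset ℤ, ∑' n : {n // n ∉ F}, ‖v n‖ < ‖v k‖ := by
    have := tendsto_tsum_compl_atTop_zero fun n => ‖v n‖
    exact (this.eventually_lt_const (norm_pos_iff.2 hk)).exists
  obtain ⟨f, hf1, hf0, hf⟩ := exists_continuous_eq_one_eq_zero_finite ((σ ^ k : X ≃ₜ X) x)
    ((fun n : ℤ => (σ ^ n : X ≃ₜ X) x) '' (↑(F.erase k))) ((Finset.finite_toSet _).image _) (by
      rintro ⟨n, hn, h⟩
      rw [hinj _ _ h] at hn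
      simp at hn)
  set b : EllOne σ := (v k)⁻¹ • (EllOne.single σ (-k) 1 * EllOne.single σ 0 f) with hb
  have h1 : ∀ n, orbitRep σ x b v n = (v k)⁻¹ * (f ((σ ^ (n + k) : X ≃ₜ X) x) * v (n + k)) := by
    intro n
    have : orbitRep σ x b v = (v k)⁻¹ • shiftBy (-k) (orbitMul σ x f v) := by
      rw [hb, map_smul, map_mul, orbitRep, CovariantPair.integrate_single,
        CovariantPair.integrate_single, map_one, one_mul, zpow_zero, Units.val_one, mul_one]
      change (v k)⁻¹ • (((rightShift ^ (-k) : (EllOneInt →L[ℂ] EllOneInt)ˣ) :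
        EllOneInt →L[ℂ] EllOneInt) (orbitMul σ x f v)) = _
      rw [rightShift_zpow]
    rw [this, lp.coeFn_smul, Pi.smul_apply, shiftBy_apply, orbitMul_apply, sub_neg_eq_add,
      smul_eq_mul]
  have h2 : ‖orbitRep σ x b v - lp.single 1 (0 : ℤ) (1 : ℂ)‖ < 1 := by
    have h3 : ∀ n, ‖(orbitRep σ x b v - lp.single 1 (0 : ℤ) (1 : ℂ) : EllOneInt) (n - k)‖
        ≤ ‖v k‖⁻¹ * (if n ∈ F then 0 else ‖v n‖) := fun n => by
      rw [lp.coeFn_sub, Pi.sub_apply, h1, sub_add_cancel, lp.single_apply, Pi.single_apply]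
      by_cases hn : n = k
      · subst hn
        simp only [hf1, one_mul, inv_mul_cancel₀ hk, sub_self, if_true, norm_zero]
        split_ifs <;> positivity
      · have : n - k ≠ 0 := sub_ne_zero.2 hn
        simp only [this, if_false, sub_zero, norm_mul, norm_inv]
        refine mul_le_mul_of_nonneg_left ?_ (by positivity)
        split_ifs with hnF
        · rw [hf0 _ ⟨n, by simp [hn, hnF], rfl⟩]; simp
        · exact mul_le_of_le_one_left (norm_nonneg _) (hf _)
    have hs : Summable fun n => (if n ∈ F then 0 else ‖v n‖) :=
      Summable.of_nonneg_of_le (fun n => by split_ifs <;> positivity)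
        (fun n => by split_ifs <;> simp) v.summable_norm
    have h4 : ∑' n, (if n ∈ F then 0 else ‖v n‖) = ∑' n : {n // n ∉ F}, ‖v n‖ := by
      have := tsum_subtype {n : ℤ | n ∉ F} fun n => ‖v n‖
      refine Eq.trans (tsum_congr fun n => ?_) this.symm
      by_cases hn : n ∈ F <;> simp [hn]
    rw [EllOneInt.norm_eq, ← (Equiv.subRight k).tsum_eq]
    calc _ ≤ ∑' n, ‖v k‖⁻¹ * (if n ∈ F then 0 else ‖v n‖) :=
          ((Equiv.subRight k).summable_iff.2 (EllOneInt.summable_norm _)).tsum_le_tsum h3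
            (hs.mul_left _)
      _ < 1 := by
          rw [tsum_mul_left, h4, inv_mul_lt_iff₀ (norm_pos_iff.2 hk), mul_one]
          exact hF
  obtain ⟨a, ha⟩ := orbitRep_transitive_of_near (σ := σ) x _ h2 w
  exact ⟨a * b, by rw [map_mul, mul_apply_eq_comp, ha]⟩

theorem isPrimitiveIdeal_ker_orbitRep [T2Space X] {x : X} (hx : x ∉ Function.periodicPts σ) :
    IsPrimitiveIdeal (TwoSidedIdeal.ker (orbitRep σ x)) := by
  have : Nontrivial EllOneInt := ⟨lp.single 1 (0 : ℤ) (1 : ℂ), 0, fun h => by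
    have := congrArg (fun v : EllOneInt => v 0) h
    simp at this⟩
  exact isPrimitiveIdeal_ker_of_transitive _ (orbitRep_transitive hx)

end Primitivity

/-! ### Nested bump functions -/

section Separation

/-- Two nested bump functions at a point. -/
theorem exists_nested_bump {X : Type*} [TopologicalSpace X] [CompactSpace X] [T2Space X] {x : X}
    {V : Set X} (hV : V ∈ 𝓝 x) : ∃ g u : C(X, ℂ), (∀ y, y ∉ V → g y = 0) ∧ (∀ y, ‖g y‖ ≤ 1) ∧
      u * g = u ∧ u x = 1 := by
  have bump : ∀ C D : Set X, IsClosed C → IsOpen D → C ⊆ D → ∃ g : C(X, ℂ),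
      (∀ y, y ∉ D → g y = 0) ∧ (∀ y, ‖g y‖ ≤ 1) ∧ ∀ y ∈ C, g y = 1 := by
    intro C D hC hD hCD
    obtain ⟨f, hf0, hf1, hf⟩ := exists_continuous_zero_one_of_isClosed hD.isClosed_compl hC
      (disjoint_compl_left_iff_subset.2 hCD)
    refine ⟨⟨fun y => (f y : ℂ), by fun_prop⟩, fun y hy => ?_, fun y => ?_, fun y hy => ?_⟩
    · simp [hf0 hy]
    · have := hf y
      simpa [abs_of_nonneg this.1] using this.2
    · simp [hf1 hy]
  -- `g` is `1` on a closed neighbourhood `C` of `x` and `u` vanishes off the interior of `C`, which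
  -- gives `u g = u`.
  obtain ⟨C, hC, hCc, hCV⟩ := exists_mem_nhds_isClosed_subset (interior_mem_nhds.2 hV)
  obtain ⟨g, hg0, hg, hg1⟩ := bump C (interior V) hCc isOpen_interior hCV
  obtain ⟨u, hu0, -, hu1⟩ := bump {x} (interior C) isClosed_singleton isOpen_interior
    (singleton_subset_iff.2 (mem_interior_iff_mem_nhds.2 hC))
  refine ⟨g, u, fun y hy => hg0 y fun h => hy (interior_subset h), hg, ?_, hu1 x rfl⟩
  ext y
  by_cases hy : y ∈ interior C
  · simp [hg1 y (interior_subset hy)]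
  · simp [hu0 y hy]

end Separation

/-! ### Every proper ideal lies in a member of `Π_X` -/

section IdealPoints

variable {X : Type u} [TopologicalSpace X] [CompactSpace X] {σ : X ≃ₜ X}

theorem EllOne.sub_apply (a b : EllOne σ) (n : ℤ) : (a - b) n = a n - b n := rfl

theorem EllOne.single_zero_mul_single_zero (f g : C(X, ℂ)) :
    EllOne.single σ 0 f * EllOne.single σ 0 g = EllOne.single σ 0 (f * g) := by
  rw [EllOne.single_mul_single, add_zero]
  congr 1

/-- If `σ^n` fixes `x`, this is continuity of `a` at `x`. If not, a small neighbourhood of `x` is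
disjoint from its image under `σ^{-n}`, and there are no returns to control. -/
theorem exists_nhds_small_of_return [T2Space X] (a : C(X, ℂ)) (x : X) (n : ℤ) (z : ℂ)
    (h : (σ ^ n : X ≃ₜ X) x = x → a x = z) {δ : ℝ} (hδ : 0 < δ) :
    ∃ V ∈ 𝓝 x, ∀ y ∈ V, (σ ^ (-n) : X ≃ₜ X) y ∈ V → ‖a y - z‖ ≤ δ := by
  by_cases hx : (σ ^ n : X ≃ₜ X) x = x
  · refine ⟨{y | ‖a y - z‖ < δ}, ?_, fun y hy _ => le_of_lt hy⟩
    refine IsOpen.mem_nhds (isOpen_lt (by fun_prop) continuous_const) ?_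
    simpa [h hx] using hδ
  · have hne : x ≠ (σ ^ (-n) : X ≃ₜ X) x := fun h' =>
      hx ((homeo_zpow_neg_apply_eq_iff σ n x x).1 h'.symm).symm
    obtain ⟨U, W, hU, hW, hxU, hxW, hd⟩ := t2_separation hne
    refine ⟨U ∩ (σ ^ (-n) : X ≃ₜ X) ⁻¹' W,
      Filter.inter_mem (hU.mem_nhds hxU) ((hW.preimage (Homeomorph.continuous _)).mem_nhds hxW), ?_⟩
    intro y hy hy'
    exact (Set.disjoint_left.1 hd hy'.1 hy.2).elim

/-- If all functions in a two-sided ideal vanish at `x`, then no element of the ideal restricts to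
the identity on the isotropy of `x`. -/
theorem not_restrict_eq_one [T2Space X] {I : TwoSidedIdeal (EllOne σ)} {x : X}
    (hx : ∀ f, EllOne.single σ 0 f ∈ I → f x = 0) {a : EllOne σ} (ha : a ∈ I) (h0 : a 0 x = 1)
    (hn : ∀ n, n ≠ 0 → (σ ^ n : X ≃ₜ X) x = x → a n x = 0) : False := by
  -- The error `d` below is at most `1/4` in total over the indices in `F`, by choice of the
  -- neighbourhoods, and below `1/4` over the rest, by the tail of `a`. Hence `‖d‖ < 1`.
  obtain ⟨F, hF, hF0⟩ : ∃ F : Finset ℤ, ∑' n : {n // n ∉ F}, ‖a n‖ < 1 / 4 ∧ {0} ≤ F := by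
    have := tendsto_tsum_compl_atTop_zero fun n => ‖a n‖
    exact ((this.eventually_lt_const (by norm_num)).and (Filter.eventually_ge_atTop {0})).exists
  have h0F : (0 : ℤ) ∈ F := hF0 (by simp)
  have hcard : 0 < (F.card : ℝ) := by exact_mod_cast Finset.card_pos.2 ⟨0, h0F⟩
  have hδ : 0 < 1 / (4 * (F.card : ℝ)) := by positivity
  choose V hV hVa using fun n : ℤ => exists_nhds_small_of_return (σ := σ) (a n) x n
    (if n = 0 then 1 else 0) (fun h => by
      split_ifs with h'
      · rw [h', h0]
      · exact hn n h' h) hδ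
  obtain ⟨g, u, hg0, hg1, hug, hux⟩ := exists_nested_bump
    ((Filter.biInter_finset_mem F).2 fun n _ => hV n)
  -- `d = g a g - g²`. At index `n` it sees only points `y` with both `y` and `σ^{-n} y` in the
  -- support of `g`, where `a n` is close to its prescribed value `1` (for `n = 0`) or `0`.
  set d : EllOne σ := EllOne.single σ 0 g * a * EllOne.single σ 0 g - EllOne.single σ 0 (g * g)
    with hd
  have hdapp : ∀ n y, d n y
      = g y * g ((σ ^ (-n) : X ≃ₜ X) y) * (a n y - if n = 0 then 1 else 0) := by
    intro n y
    rw [hd, EllOne.sub_apply, EllOne.mul_single_apply, EllOne.single_mul_apply, EllOne.single_apply,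
      sub_zero, sub_zero]
    split_ifs with h
    · subst h
      change g y * a 0 y * g y - g y * g y = g y * g y * (a 0 y - 1)
      ring
    · change g y * a n y * g ((σ ^ (-n) : X ≃ₜ X) y) - 0 = _
      ring
  have hgg : ∀ (n : ℤ) y, ‖g y * g ((σ ^ (-n) : X ≃ₜ X) y)‖ ≤ 1 := fun n y => by
    rw [norm_mul]
    exact mul_le_one₀ (hg1 _) (norm_nonneg _) (hg1 _)
  have hdF : ∀ n ∈ F, ‖d n‖ ≤ 1 / (4 * (F.card : ℝ)) := fun n hnF => by
    refine (ContinuousMap.norm_le _ hδ.le).2 fun y => ?_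
    rw [hdapp]
    by_cases hy : y ∈ V n ∧ (σ ^ (-n) : X ≃ₜ X) y ∈ V n
    · rw [norm_mul]
      refine (mul_le_of_le_one_left (norm_nonneg _) (hgg n y)).trans (hVa n y hy.1 hy.2)
    · have : g y * g ((σ ^ (-n) : X ≃ₜ X) y) = 0 := by
        rcases not_and_or.1 hy with h | h
        · rw [hg0 y (fun h' => h (Set.mem_iInter₂.1 h' n hnF)), zero_mul]
        · rw [hg0 _ (fun h' => h (Set.mem_iInter₂.1 h' n hnF)), mul_zero]
      rw [this, zero_mul, norm_zero]
      exact hδ.le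
  have hdF' : ∀ n : {n // n ∉ F}, ‖d n‖ ≤ ‖a n‖ := fun n => by
    refine (ContinuousMap.norm_le _ (norm_nonneg _)).2 fun y => ?_
    have hn0 : (n : ℤ) ≠ 0 := fun h => n.2 (h ▸ h0F)
    rw [hdapp, if_neg hn0, sub_zero, norm_mul]
    exact (mul_le_of_le_one_left (norm_nonneg _) (hgg n y)).trans (EllOne.norm_apply_apply_le _ _ _)
  have hdn : ‖-d‖ < 1 := by
    rw [norm_neg, EllOne.norm_eq, ← (EllOne.summable_norm d).sum_add_tsum_subtype_compl F]
    have h1 : ∑ n ∈ F, ‖d n‖ ≤ 1 / 4 := by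
      refine (Finset.sum_le_card_nsmul _ _ _ hdF).trans (le_of_eq ?_)
      rw [nsmul_eq_mul]
      field_simp
    have h2 : ∑' n : {n // n ∉ F}, ‖d n‖ ≤ ∑' n : {n // n ∉ F}, ‖a n‖ :=
      ((EllOne.summable_norm d).comp_injective Subtype.val_injective).tsum_le_tsum hdF'
        ((EllOne.summable_norm a).comp_injective Subtype.val_injective)
    change _ + ∑' n : {n // n ∉ F}, ‖d n‖ < 1
    linarith
  -- Since `u g = u`, one has `u (1 + d) = u g a g`, which lies in `I`; cancelling the invertible `1
  -- + d` leaves `u ∈ I`, although `u x = 1`.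
  have hu : EllOne.single σ 0 u * (Units.oneSub (-d) hdn : EllOne σ) ∈ I := by
    have : EllOne.single σ 0 u * (Units.oneSub (-d) hdn : EllOne σ)
        = EllOne.single σ 0 u * (EllOne.single σ 0 g * a * EllOne.single σ 0 g) := by
      rw [Units.val_oneSub, sub_neg_eq_add, mul_add, mul_one, hd, mul_sub,
        EllOne.single_zero_mul_single_zero u, ← mul_assoc u, hug, hug]
      abel
    rw [this]
    exact I.mul_mem_left _ _ (I.mul_mem_right _ _ (I.mul_mem_left _ _ ha))
  have hu' := I.mul_mem_right _ ((Units.oneSub (-d) hdn)⁻¹ : (EllOne σ)ˣ).val hu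
  rw [mul_assoc, Units.mul_inv, mul_one] at hu'
  exact one_ne_zero (hux.symm.trans (hx u hu'))

/-- The functions in a proper two-sided ideal have a common zero. -/
theorem exists_common_zero [T2Space X] {I : TwoSidedIdeal (EllOne σ)} (hI : 1 ∉ I) :
    ∃ x, ∀ f, EllOne.single σ 0 f ∈ I → f x = 0 := by
  let K : Ideal C(X, ℂ) :=
    { carrier := {f | EllOne.single σ 0 f ∈ I}
      zero_mem' := by simp
      add_mem' := fun {f g} hf hg => by
        change EllOne.single σ 0 (f + g) ∈ I
        rw [map_add]
        exact I.add_mem hf hg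
      smul_mem' := fun c f hf => by
        change EllOne.single σ 0 (c * f) ∈ I
        rw [← EllOne.single_zero_mul_single_zero]
        exact I.mul_mem_left _ _ hf }
  have hK : K ≠ ⊤ := fun h => hI ((Ideal.eq_top_iff_one K).1 h)
  obtain ⟨M, hM, hKM⟩ := K.exists_le_maximal hK
  -- Maximal ideals of the Banach algebra `C(X)` are closed, hence of the form `{f | f x = 0}`.
  have hMc : IsClosed (M : Set C(X, ℂ)) := inferInstance
  obtain ⟨x, hx⟩ := (ContinuousMap.ideal_isMaximal_iff M).1 hM
  refine ⟨x, fun f hf => ?_⟩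
  have h := hKM (show f ∈ K from hf)
  rw [← hx] at h
  exact ContinuousMap.mem_idealOfSet.1 h (by simp)

theorem le_ker_orbitRep [T2Space X] {I : TwoSidedIdeal (EllOne σ)} {x : X}
    (hxI : ∀ f, EllOne.single σ 0 f ∈ I → f x = 0) (hx : x ∉ Function.periodicPts σ) :
    I ≤ TwoSidedIdeal.ker (orbitRep σ x) := by
  have key : ∀ a ∈ I, ∀ k n : ℤ, a n ((σ ^ k : X ≃ₜ X) x) = 0 := by
    intro a ha k n
    by_contra h
    -- The translate `δ^{-k} a δ^{k-n}` moves the coefficient `a n (σ^k x)` to index `0` at `x`. The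
    -- isotropy of `x` is trivial, so after normalisation `b` restricts to the identity on it.
    set b := (a n ((σ ^ k : X ≃ₜ X) x))⁻¹ •
      (EllOne.single σ (-k) 1 * a * EllOne.single σ (k - n) 1) with hb
    refine not_restrict_eq_one hxI (a := b) ?_ ?_ fun m hm hmx => ?_
    · rw [hb, ← mul_one (_ * a * _), ← mul_smul_comm]
      exact I.mul_mem_right _ _ (I.mul_mem_right _ _ (I.mul_mem_left _ _ ha))
    · rw [hb, EllOne.smul_apply, EllOne.mul_single_apply, EllOne.single_mul_apply]
      have h1 : 0 - (k - n) - -k = n := by ring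
      rw [h1]
      simp [EllOne.alphaPow_apply, h]
    · rw [homeo_zpow_fixed_iff, Function.minimalPeriod_eq_zero_of_notMem_periodicPts hx] at hmx
      exact (hm (by simpa using hmx)).elim
  intro a ha
  rw [TwoSidedIdeal.mem_ker]
  ext v k
  rw [orbitRep_apply_apply]
  simp [key a ha]

/-- The convolution algebra `ℓ¹(ℤ)`. -/
abbrev ConvAlg : Type := EllOne (Homeomorph.refl Unit)

theorem ConvAlg.alphaPow_eq (k : ℤ) (f : C(Unit, ℂ)) : alphaPow (Homeomorph.refl Unit) k f = f := by
  ext; rfl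

protected theorem ConvAlg.mul_comm (a b : ConvAlg) : a * b = b * a := by
  have key : EllOne.mulL (Homeomorph.refl Unit) = (EllOne.mulL (Homeomorph.refl Unit)).flip := by
    refine EllOne.clm_ext fun i f => EllOne.clm_ext fun j g => ?_
    change EllOne.single _ i f * EllOne.single _ j g = EllOne.single _ j g * EllOne.single _ i f
    rw [EllOne.single_mul_single, EllOne.single_mul_single, ConvAlg.alphaPow_eq,
      ConvAlg.alphaPow_eq, add_comm, mul_comm]
  exact congrArg (fun T => T a b) key

noncomputable instance : NormedCommRing ConvAlg :=
  { (inferInstance : NormedRing ConvAlg) with mul_comm := ConvAlg.mul_comm }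

/-- The sequence supported on the multiples of `p` with value `c m` at `pm`. -/
noncomputable def spread (p : ℕ) (c : ℤ → ℂ) (n : ℤ) : ℂ := if (p : ℤ) ∣ n then c (n / p) else 0

theorem spread_mul {p : ℕ} (hp : p ≠ 0) (c : ℤ → ℂ) (m : ℤ) : spread p c (p * m) = c m := by
  rw [spread, if_pos (dvd_mul_right _ _), Int.mul_ediv_cancel_left _ (by exact_mod_cast hp)]

theorem spread_of_not_dvd {p : ℕ} {c : ℤ → ℂ} {n : ℤ} (h : ¬ (p : ℤ) ∣ n) : spread p c n = 0 :=
  if_neg h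

theorem summable_norm_spread {p : ℕ} (hp : p ≠ 0) {c : ℤ → ℂ} (hc : Summable fun n => ‖c n‖) :
    Summable fun n => ‖spread p c n‖ := by
  have hinj : Function.Injective fun m : ℤ => (p : ℤ) * m :=
    mul_right_injective₀ (by exact_mod_cast hp)
  rw [← hinj.summable_iff]
  · simpa only [Function.comp_def, spread_mul hp] using hc
  · intro n hn
    rw [spread_of_not_dvd (fun h => hn (h.imp fun _ => Eq.symm)), norm_zero]

/-- The elements of `ℓ¹(ℤ)` that arise by restricting elements of `I` to the isotropy of `x`. -/
noncomputable def isotropyIdeal (I : TwoSidedIdeal (EllOne σ)) (x : X)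
    (hx : x ∈ Function.periodicPts σ) : Ideal ConvAlg where
  carrier := {b | ∃ a ∈ I, ∀ m, b m () = a (Function.minimalPeriod σ x * m) x}
  zero_mem' := ⟨0, I.zero_mem, fun _ => rfl⟩
  add_mem' := by
    rintro b c ⟨a, ha, hab⟩ ⟨a', ha', hac⟩
    refine ⟨a + a', I.add_mem ha ha', fun m => ?_⟩
    rw [EllOne.add_apply, EllOne.add_apply, ContinuousMap.add_apply, ContinuousMap.add_apply, hab,
      hac]
  smul_mem' := by
    rintro c b ⟨a, ha, hab⟩
    have hp : (Function.minimalPeriod σ x : ℤ) ≠ 0 := by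
      exact_mod_cast (Function.minimalPeriod_pos_of_mem_periodicPts hx).ne'
    set p := Function.minimalPeriod σ x with hpdef
    have hinj : Function.Injective fun m : ℤ => (p : ℤ) * m := mul_right_injective₀ hp
    -- `c` is lifted to constant coefficients supported on `pℤ`. Since `σ^{pm} x = x`, twisted
    -- convolution with it at `x` is ordinary convolution with `c`.
    let c' : ℤ → ℂ := spread p fun m => c m ()
    have hc' : Summable fun n => ‖c' n‖ := summable_norm_spread (by exact_mod_cast hp)
      (Summable.of_nonneg_of_le (fun _ => norm_nonneg _)
        (fun _ => EllOne.norm_apply_apply_le _ _ _) (EllOne.summable_norm c))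
    refine ⟨constElement σ c' hc' * a, I.mul_mem_left _ _ ha, fun n => ?_⟩
    have h1 : (c • b : ConvAlg) n () = ∑' k, c k () * b (n - k) () := by
      change (ContinuousMap.evalCLM ℂ ()) ((c * b : ConvAlg) n) = _
      rw [EllOne.mul_apply, ContinuousLinearMap.map_tsum _ (EllOne.summable_mul_apply c b n)]
      rfl
    have h2 : (constElement σ c' hc' * a) (p * n) x
        = ∑' k, c' k * a (p * n - k) ((σ ^ (-k) : X ≃ₜ X) x) := by
      change (ContinuousMap.evalCLM ℂ x) _ = _
      rw [EllOne.mul_apply, ContinuousLinearMap.map_tsum _ (EllOne.summable_mul_apply _ a _)]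
      rfl
    rw [h1, h2]
    refine Eq.trans (tsum_congr fun m => ?_) (hinj.tsum_eq ?_)
    · have h3 : (σ ^ (-((p : ℤ) * m)) : X ≃ₜ X) x = x := by
        rw [← mul_neg]
        exact homeo_zpow_minimalPeriod_mul_apply σ x _
      have h4 : c' (p * m) = c m () := spread_mul (by exact_mod_cast hp) _ m
      rw [h4, h3, ← mul_sub, ← hab]
    · intro k hk
      by_contra hk'
      refine hk ?_
      simp only [c', spread_of_not_dvd (fun h => hk' (h.imp fun _ => Eq.symm)), zero_mul]

theorem isotropyIdeal_ne_top [T2Space X] {I : TwoSidedIdeal (EllOne σ)} {x : X}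
    (hxI : ∀ f, EllOne.single σ 0 f ∈ I → f x = 0) (hx : x ∈ Function.periodicPts σ) :
    isotropyIdeal I x hx ≠ ⊤ := by
  intro h
  obtain ⟨a, ha, hab⟩ := (Ideal.eq_top_iff_one _).1 h
  refine not_restrict_eq_one hxI ha ?_ fun n hn hnx => ?_
  · have := hab 0
    rw [mul_zero] at this
    rw [← this, EllOne.one_def, EllOne.single_apply, if_pos rfl]
    rfl
  · obtain ⟨m, rfl⟩ := (homeo_zpow_fixed_iff σ x n).1 hnx
    have hm : m ≠ 0 := fun h => hn (by rw [h, mul_zero])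
    rw [← hab, EllOne.one_def, EllOne.single_apply, if_neg hm]
    rfl

/-- The characters of `ℓ¹(ℤ)` are the evaluations at the points of the circle. -/
theorem ConvAlg.character_apply (χ : WeakDual.characterSpace ℂ ConvAlg) :
    ∃ lam : Circle, ∀ b : ConvAlg, χ b = ∑' m : ℤ, b m () * (lam : ℂ) ^ m := by
  let e : ℤ → ConvAlg := fun m => EllOne.single (Homeomorph.refl Unit) m 1
  have hadd : ∀ m n, e m * e n = e (m + n) := fun m n => by
    simp only [e, EllOne.single_mul_single, ConvAlg.alphaPow_eq, mul_one]
  have hχadd : ∀ m n, χ (e (m + n)) = χ (e m) * χ (e n) := fun m n => by rw [← hadd, map_mul]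
  have h0 : χ (e 0) = 1 := map_one χ
  have hle : ∀ m, ‖χ (e m)‖ ≤ 1 := fun m => by
    refine (AlgHom.norm_apply_le_self_mul_norm_one (WeakDual.CharacterSpace.toAlgHom χ) (e m)).trans
      ?_
    have h1 : ∀ n, ‖e n‖ ≤ 1 := fun n => by
      rw [EllOne.norm_single]; exact norm_one.le
    exact mul_le_one₀ (h1 m) (norm_nonneg _) (h1 0)
  have hinv : χ (e 1) * χ (e (-1)) = 1 := by rw [← hχadd, ← h0]; rfl
  have hne : χ (e 1) ≠ 0 := left_ne_zero_of_mul_eq_one hinv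
  have hnorm : ‖χ (e 1)‖ = 1 := by
    have h1 : ‖χ (e 1)‖ * ‖χ (e (-1))‖ = 1 := by rw [← norm_mul, hinv, norm_one]
    -- `χ(δ)` and its inverse `χ(δ⁻¹)` both have modulus at most `1`, which forces modulus `1`.
    nlinarith [hle 1, hle (-1), norm_nonneg (χ (e 1)), norm_nonneg (χ (e (-1)))]
  have hpow : ∀ m : ℤ, χ (e m) = χ (e 1) ^ m := fun m => by
    induction m with
    | zero => rw [h0, zpow_zero]
    | succ m ih => rw [hχadd, ih, zpow_add_one₀ hne]
    | pred m ih => rw [sub_eq_add_neg, hχadd, ih, ← sub_eq_add_neg, zpow_sub_one₀ hne,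
        eq_inv_of_mul_eq_one_right hinv]
  refine ⟨⟨χ (e 1), mem_sphere_zero_iff_norm.2 hnorm⟩, fun b => ?_⟩
  have hsum : HasSum (fun m => EllOne.single (Homeomorph.refl Unit) m (b m)) b :=
    lp.hasSum_single (E := fun _ : ℤ => C(Unit, ℂ)) (p := 1) (by simp) b
  refine ((hsum.map χ (map_continuous χ)).tsum_eq.symm).trans (tsum_congr fun m => ?_)
  have hs : EllOne.single (Homeomorph.refl Unit) m (b m) = (b m ()) • e m := by
    rw [← map_smul]
    congr 1
    ext
    simp
  rw [Function.comp_apply, hs, map_smul, hpow, smul_eq_mul]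

/-- A maximal ideal over the isotropy ideal is the kernel of evaluation at some `λ`. Two-sidedness
of `I` transfers this vanishing to the series at every `σ^i x` and every shift `k`. -/
theorem exists_le_ker_periodicRep [T2Space X] {I : TwoSidedIdeal (EllOne σ)} {x : X}
    (hxI : ∀ f, EllOne.single σ 0 f ∈ I → f x = 0) (hx : x ∈ Function.periodicPts σ) :
    ∃ lam, I ≤ TwoSidedIdeal.ker (periodicRep σ x lam) := by
  obtain ⟨M, hM, hIM⟩ := (isotropyIdeal I x hx).exists_le_maximal (isotropyIdeal_ne_top hxI hx)
  obtain ⟨lam, hlam⟩ := ConvAlg.character_apply M.toCharacterSpace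
  refine ⟨lam, fun a ha => ?_⟩
  rw [mem_ker_periodicRep_iff a hx]
  intro i k
  have hp : 0 < Function.minimalPeriod σ x := Function.minimalPeriod_pos_of_mem_periodicPts hx
  have hinj : Function.Injective fun m : ℤ => (Function.minimalPeriod σ x : ℤ) * m + k :=
    fun m n h => by simpa [hp.ne'] using h
  let b : ConvAlg := constElement (Homeomorph.refl Unit)
    (fun m => a (Function.minimalPeriod σ x * m + k) ((σ ^ i : X ≃ₜ X) x))
    (Summable.of_nonneg_of_le (fun _ => norm_nonneg _) (fun _ => EllOne.norm_apply_apply_le _ _ _)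
      ((EllOne.summable_norm a).comp_injective hinj))
  have hb : b ∈ isotropyIdeal I x hx := by
    -- The coefficient of `δ^{-i} a δ^{i-k}` at index `pm`, evaluated at `x`, is `a(pm + k)(σ^i x)`.
    refine ⟨EllOne.single σ (-i) 1 * a * EllOne.single σ (i - k) 1,
      I.mul_mem_right _ _ (I.mul_mem_left _ _ ha), fun m => ?_⟩
    rw [EllOne.mul_single_apply, EllOne.single_mul_apply]
    have h1 : (Function.minimalPeriod σ x : ℤ) * m - (i - k) - -i
        = Function.minimalPeriod σ x * m + k := by ring
    rw [h1]
    simp only [ContinuousMap.mul_apply, EllOne.alphaPow_apply, ContinuousMap.one_apply, one_mul,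
      mul_one, neg_neg]
    rfl
  have := M.toCharacterSpace_apply_eq_zero_of_mem (hIM hb)
  rw [hlam] at this
  exact this

/-- Every proper two-sided ideal is contained in an element of `Π_X`. -/
theorem exists_mem_structureSet_ge [T2Space X] {I : TwoSidedIdeal (EllOne σ)} (hI : 1 ∉ I) :
    ∃ P ∈ structureSet σ univ, I ≤ P.ideal := by
  obtain ⟨x, hx⟩ := exists_common_zero hI
  by_cases hper : x ∈ Function.periodicPts σ
  · obtain ⟨lam, hlam⟩ := exists_le_ker_periodicRep hx hper
    exact ⟨⟨_, isPrimitiveIdeal_ker_periodicRep hper lam⟩,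
      Or.inl ⟨x, mem_univ x, hper, lam, rfl⟩, hlam⟩
  · exact ⟨⟨_, isPrimitiveIdeal_ker_orbitRep hper⟩, Or.inr ⟨x, mem_univ x, hper, rfl⟩,
      le_ker_orbitRep hx hper⟩

end IdealPoints

/-! ### From ideals to compactness -/

section Compactness

variable {A : Type u} [Ring A] [Algebra ℂ A]

theorem StructureSpace.one_notMem_ideal (P : StructureSpace A) : 1 ∉ P.ideal := by
  obtain ⟨I, E, _, _, π, ⟨⟨a, e, h⟩, -⟩, rfl⟩ := P
  intro h1
  have h2 := (TwoSidedIdeal.ker π).mul_mem_left a 1 h1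
  rw [mul_one, TwoSidedIdeal.mem_ker] at h2
  exact h (by rw [h2]; rfl)

/-- A set of primitive ideals is compact if each proper two-sided ideal is contained in one of its
elements. -/
theorem StructureSpace.isCompact_of_forall_exists_ge {Q : Set (StructureSpace A)}
    (h : ∀ I : TwoSidedIdeal A, 1 ∉ I → ∃ P ∈ Q, I ≤ P.ideal) : IsCompact Q := by
  refine isCompact_of_finite_subfamily_closed fun {ι} Z hZ hempty => ?_
  by_contra! hne
  -- The union of the kernels of the finite intersections, an ideal because it is directed. It is
  -- proper because each finite intersection contains a primitive ideal, which omits `1`.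
  let J : TwoSidedIdeal A := TwoSidedIdeal.mk'
    {a | ∃ t : Finset ι, a ∈ kernel (Q ∩ ⋂ i ∈ t, Z i)}
    ⟨∅, TwoSidedIdeal.zero_mem _⟩
    (by
      classical
      rintro a b ⟨s, hs⟩ ⟨t, ht⟩
      refine ⟨s ∪ t, TwoSidedIdeal.add_mem _
        (kernel_anti (inter_subset_inter_right _ ?_) hs)
        (kernel_anti (inter_subset_inter_right _ ?_) ht)⟩
      · exact biInter_subset_biInter_left fun i hi => Finset.mem_union_left _ hi
      · exact biInter_subset_biInter_left fun i hi => Finset.mem_union_right _ hi)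
    (by
      rintro a ⟨s, hs⟩
      exact ⟨s, TwoSidedIdeal.neg_mem _ hs⟩)
    (by
      rintro a b ⟨s, hs⟩
      exact ⟨s, TwoSidedIdeal.mul_mem_left _ _ _ hs⟩)
    (by
      rintro a b ⟨s, hs⟩
      exact ⟨s, TwoSidedIdeal.mul_mem_right _ _ _ hs⟩)
  have hJ : 1 ∉ J := by
    rw [TwoSidedIdeal.mem_mk']
    rintro ⟨t, ht⟩
    obtain ⟨P, hP⟩ := hne t
    exact P.one_notMem_ideal (mem_kernel.1 ht P hP)
  obtain ⟨P, hP, hJP⟩ := h J hJ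
  have : P ∈ Q ∩ ⋂ i, Z i := by
    refine ⟨hP, mem_iInter.2 fun i => isClosed_iff.1 (hZ i) fun a ha => hJP ?_⟩
    rw [TwoSidedIdeal.mem_mk']
    exact ⟨{i}, kernel_anti (by simp) ha⟩
  rw [hempty] at this
  exact this

theorem isCompact_structureSet_univ {X : Type u} [TopologicalSpace X] [CompactSpace X] [T2Space X]
    (σ : X ≃ₜ X) : IsCompact (structureSet σ univ) :=
  StructureSpace.isCompact_of_forall_exists_ge fun _ hI => exists_mem_structureSet_ge hI

end Compactness

/-! ### Localised functions on the circle with summable Fourier coefficients -/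

section CircleBump

/-- This is the Fourier series of the Bernoulli polynomial `x² - x + 1/6` on `[0, 1]`, which has
mean zero. The convention `1 / 0 = 0` supplies the vanishing term at `n = 0`. -/
theorem hasSum_one_div_sq_mul_exp_zpow {x : ℝ} (hx : x ∈ Icc (0 : ℝ) 1) :
    HasSum (fun n : ℤ => 1 / (n : ℂ) ^ 2 * (Circle.exp (2 * Real.pi * x) : ℂ) ^ n)
      (2 * (Real.pi : ℂ) ^ 2 * ((x : ℂ) ^ 2 - x + 6⁻¹)) := by
  have h := hasSum_one_div_pow_mul_fourier_mul_bernoulliFun le_rfl hx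
  convert! h using 1
  · ext n
    rw [fourier_coe_apply, Circle.coe_exp, ← Complex.exp_int_mul]
    congr 2
    push_cast
    ring
  · rw [bernoulliFun_two]
    push_cast
    rw [mul_pow, Complex.I_sq, Nat.factorial_two]
    push_cast
    ring

/-- Near the identity of the circle there are non-trivial functions with absolutely summable Fourier
coefficients (second differences of the second periodic Bernoulli function). -/
theorem exists_fourier_bump_one {V : Set Circle} (hV : V ∈ 𝓝 (1 : Circle)) :
    ∃ c : ℤ → ℂ, (Summable fun n => ‖c n‖) ∧ (∀ lam ∉ V, ∑' n, c n * (lam : ℂ) ^ n = 0) ∧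
      ∑' n, c n ≠ 0 := by
  set e : ℝ → Circle := fun t => Circle.exp (2 * Real.pi * t) with he
  have hecont : Continuous e := by fun_prop
  have he0 : e 0 = 1 := by simp [he]
  have hadd : ∀ s t, e (s + t) = e s * e t := fun s t => by
    simp only [he, mul_add, Circle.exp_add]
  have he1 : e 1 = 1 := by simp [he]
  obtain ⟨ε, hε, hball⟩ := Metric.mem_nhds_iff.1
    (hecont.continuousAt.preimage_mem_nhds (by rwa [he0] : V ∈ 𝓝 (e 0)))
  -- The bound `h ≤ 1/2` gives `h ≤ 1 - h`, so that `[h, 1 - h]` is non-empty.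
  set h := min ε (1 / 2) with hh
  have hpos : 0 < h := lt_min hε (by norm_num)
  have hhalf : h ≤ 1 / 2 := min_le_right _ _
  have hmem : ∀ t, |t| < h → e t ∈ V := fun t ht => hball (by
    rw [Metric.mem_ball, Real.dist_eq, sub_zero]; exact ht.trans_le (min_le_left _ _))
  -- Coefficients of the second difference with step `h` of `2π²(t² - t + 1/6)`, extended
  -- periodically, minus the constant `4π²h²`. Away from the corner at `0`, for `t` in `[h, 1 - h]`,
  -- the second difference equals this constant and the function vanishes; at `t = 0` it equals
  -- `-4π²h`. The shift by `-h` is written `1 - h` to remain in `[0, 1]`.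
  set c : ℤ → ℂ := fun n => 1 / (n : ℂ) ^ 2 * ((e h : ℂ) ^ n + (e (1 - h) : ℂ) ^ n - 2)
    - if n = 0 then 4 * (Real.pi : ℂ) ^ 2 * (h : ℂ) ^ 2 else 0 with hc
  have key : ∀ t r s : ℝ, t ∈ Icc (0 : ℝ) 1 → r ∈ Icc (0 : ℝ) 1 → s ∈ Icc (0 : ℝ) 1 →
      e r = e h * e t → e s = e (1 - h) * e t →
      HasSum (fun n => c n * (e t : ℂ) ^ n) (2 * (Real.pi : ℂ) ^ 2 *
        ((r : ℂ) ^ 2 - r + 6⁻¹ + ((s : ℂ) ^ 2 - s + 6⁻¹) - 2 * ((t : ℂ) ^ 2 - t + 6⁻¹)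
          - 2 * (h : ℂ) ^ 2)) := by
    intro t r s ht hr hs her hes
    have H := (((hasSum_one_div_sq_mul_exp_zpow hr).add (hasSum_one_div_sq_mul_exp_zpow hs)).sub
      ((hasSum_one_div_sq_mul_exp_zpow ht).mul_left 2)).sub
      (hasSum_ite_eq (0 : ℤ) (4 * (Real.pi : ℂ) ^ 2 * (h : ℂ) ^ 2))
    convert! H using 1
    · ext n
      change c n * (e t : ℂ) ^ n = 1 / (n : ℂ) ^ 2 * (e r : ℂ) ^ n + 1 / (n : ℂ) ^ 2 * (e s : ℂ) ^ n
        - 2 * (1 / (n : ℂ) ^ 2 * (e t : ℂ) ^ n) - _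
      rw [her, hes, Circle.coe_mul, Circle.coe_mul, mul_zpow, mul_zpow]
      simp only [hc]
      split_ifs with hn
      · subst hn; simp
      · ring
    · ring
  refine ⟨c, ?_, fun lam hlam => ?_, ?_⟩
  · have hs1 : Summable fun n : ℤ => 1 / (n : ℝ) ^ 2 := Real.summable_one_div_int_pow.2 one_lt_two
    have hs2 : Summable fun n : ℤ => if n = 0 then ‖4 * (Real.pi : ℂ) ^ 2 * (h : ℂ) ^ 2‖ else 0 :=
      (hasSum_ite_eq (0 : ℤ) _).summable
    -- The `4` is the bound `1 + 1 + 2` for the bracket in `c`.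
    refine Summable.of_nonneg_of_le (fun _ => norm_nonneg _) (fun n => ?_)
      ((hs1.mul_right 4).add hs2)
    refine (norm_sub_le _ _).trans (add_le_add ?_ ?_)
    · rw [norm_mul, norm_div, norm_one, norm_pow, Complex.norm_intCast, sq_abs]
      refine mul_le_mul_of_nonneg_left ?_ (by positivity)
      refine (norm_sub_le _ _).trans ((add_le_add_left (norm_add_le _ _) _).trans ?_)
      simp only [norm_zpow, Circle.norm_coe, one_zpow, Complex.norm_ofNat]
      norm_num
    · split_ifs <;> simp
  · obtain ⟨t, ⟨ht0, ht1⟩, rfl⟩ : ∃ t ∈ Ico (0 : ℝ) 1, e t = lam := by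
      obtain ⟨θ, rfl⟩ := Circle.exp_surjective lam
      refine ⟨Int.fract (θ / (2 * Real.pi)), ⟨Int.fract_nonneg _, Int.fract_lt_one _⟩, ?_⟩
      have : Circle.exp θ = e (Int.fract (θ / (2 * Real.pi)) + ⌊θ / (2 * Real.pi)⌋) := by
        rw [Int.fract_add_floor]
        simp only [he]
        congr 1
        field_simp
      rw [this, hadd]
      have h1 : e (⌊θ / (2 * Real.pi)⌋ : ℝ) = 1 := by
        simp only [he]
        rw [mul_comm, Circle.exp_int_mul_two_pi]
      rw [h1, mul_one]
    have hth : h ≤ t := by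
      by_contra! hlt
      exact hlam (hmem t (by rwa [abs_of_nonneg ht0]))
    have hth' : t ≤ 1 - h := by
      by_contra! hlt
      refine hlam ?_
      have : e t = e (t - 1) := by rw [← sub_add_cancel t 1, hadd, he1, mul_one, sub_add_cancel]
      rw [this]
      exact hmem _ (by rw [abs_lt]; constructor <;> linarith)
    rw [(key t (h + t) (t - h) ⟨ht0, ht1.le⟩ ⟨by linarith, by linarith⟩ ⟨by linarith, by linarith⟩
      (hadd _ _) (by rw [← hadd, show 1 - h + t = t - h + 1 by ring, hadd, he1, mul_one])).tsum_eq]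
    push_cast
    ring
  · have H := (key 0 h (1 - h) ⟨le_rfl, zero_le_one⟩ ⟨hpos.le, by linarith⟩
      ⟨by linarith, by linarith⟩ (by rw [he0, mul_one]) (by rw [he0, mul_one])).tsum_eq
    simp only [he0, Circle.coe_one, one_zpow, mul_one] at H
    rw [H]
    have h1 : (2 * (Real.pi : ℂ) ^ 2 * ((h : ℂ) ^ 2 - h + 6⁻¹ + (((1 - h : ℝ) : ℂ) ^ 2
        - ((1 - h : ℝ) : ℂ) + 6⁻¹) - 2 * (((0 : ℝ) : ℂ) ^ 2 - ((0 : ℝ) : ℂ) + 6⁻¹)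
          - 2 * (h : ℂ) ^ 2)) = -4 * (Real.pi : ℂ) ^ 2 * h := by
      push_cast; ring
    rw [h1]
    have h2 : (h : ℂ) ≠ 0 := by exact_mod_cast hpos.ne'
    have h3 : (Real.pi : ℂ) ≠ 0 := by exact_mod_cast Real.pi_ne_zero
    simp [h2, h3]

theorem exists_fourier_bump {mu : Circle} {V : Set Circle} (hV : V ∈ 𝓝 mu) :
    ∃ c : ℤ → ℂ, (Summable fun n => ‖c n‖) ∧ (∀ lam ∉ V, ∑' n, c n * (lam : ℂ) ^ n = 0) ∧
      ∑' n, c n * (mu : ℂ) ^ n ≠ 0 := by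
  have hcont : Continuous fun lam : Circle => mu * lam := by fun_prop
  obtain ⟨c, hc, hc0, hc1⟩ := exists_fourier_bump_one
    (hcont.continuousAt.preimage_mem_nhds (by rwa [mul_one] : V ∈ 𝓝 (mu * 1)))
  have key : ∀ (lam : Circle) (n : ℤ),
      c n * ((mu⁻¹ : Circle) : ℂ) ^ n * (lam : ℂ) ^ n = c n * ((mu⁻¹ * lam : Circle) : ℂ) ^ n :=
    fun lam n => by rw [mul_assoc, ← mul_zpow, Circle.coe_mul]
  refine ⟨fun n => c n * ((mu⁻¹ : Circle) : ℂ) ^ n, ?_, fun lam hlam => ?_, ?_⟩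
  · simpa only [norm_mul, norm_zpow, Circle.norm_coe, one_zpow, mul_one] using hc
  · simp only [key]
    exact hc0 _ (by simpa using hlam)
  · simpa only [key, inv_mul_cancel, Circle.coe_one, one_zpow, mul_one] using hc1

end CircleBump

/-! ### Topology of the orbit space -/

section OrbitSpaceTopology

variable {X : Type u} [TopologicalSpace X] {σ : X ≃ₜ X} {S : Set X}

theorem homeo_zpow_mem (hinv : σ '' S = S) {x : X} (hx : x ∈ S) (n : ℤ) :
    (σ ^ n : X ≃ₜ X) x ∈ S := by
  have h1 : ∀ y ∈ S, σ y ∈ S := fun y hy => hinv ▸ mem_image_of_mem _ hy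
  have h2 : ∀ y ∈ S, (σ ^ (-1 : ℤ) : X ≃ₜ X) y ∈ S := fun y hy => by
    obtain ⟨z, hz, rfl⟩ : y ∈ σ '' S := hinv.symm ▸ hy
    have : (σ ^ (-1 : ℤ) : X ≃ₜ X) (σ z) = z := (homeo_zpow_neg_apply_eq_iff σ 1 _ _).2 rfl
    rwa [this]
  induction n with
  | zero => exact hx
  | succ n ih =>
    rw [add_comm, homeo_zpow_add_apply]
    exact h1 _ ih
  | pred n ih =>
    rw [sub_eq_add_neg, add_comm, homeo_zpow_add_apply]
    exact h2 _ ih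

theorem orbitSpace_mk_eq_iff {x y : S} :
    (Quotient.mk (orbitSetoid σ S) x) = Quotient.mk _ y ↔ ∃ n : ℤ, (σ ^ n : X ≃ₜ X) (x : X) = y :=
  Quotient.eq

theorem isOpenQuotientMap_orbitSpace_mk (hinv : σ '' S = S) :
    IsOpenQuotientMap (Quotient.mk (orbitSetoid σ S)) := by
  refine ⟨Quotient.mk_surjective, continuous_quotient_mk', fun U hU => ?_⟩
  have h : Quotient.mk (orbitSetoid σ S) ⁻¹' (Quotient.mk (orbitSetoid σ S) '' U)
      = ⋃ n : ℤ, {y : S | (⟨(σ ^ n : X ≃ₜ X) y, homeo_zpow_mem hinv y.2 n⟩ : S) ∈ U} := by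
    ext y
    simp only [mem_preimage, mem_image, mem_iUnion, mem_ofPred_eq]
    constructor
    · rintro ⟨x, hx, hxy⟩
      obtain ⟨n, hn⟩ := orbitSpace_mk_eq_iff.1 hxy.symm
      exact ⟨n, by simpa only [hn] using hx⟩
    · rintro ⟨n, hn⟩
      exact ⟨_, hn, (orbitSpace_mk_eq_iff.2 ⟨n, rfl⟩).symm⟩
  change IsOpen (Quotient.mk (orbitSetoid σ S) ⁻¹' _)
  rw [h]
  refine isOpen_iUnion fun n => hU.preimage ?_
  exact ((σ ^ n : X ≃ₜ X).continuous.comp continuous_subtype_val).subtype_mk _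

/-- A locally constant period on a compact set takes finitely many values, so it is bounded by some
`N`. The orbit relation is then a finite union of graphs of powers of `σ`, hence closed, and the
quotient map is open. -/
theorem t2Space_orbitSpace [CompactSpace X] [T2Space X] (hS : IsClosed S) (hinv : σ '' S = S)
    (hper : S ⊆ Function.periodicPts σ)
    (hloc : IsLocallyConstant fun x : S => Function.minimalPeriod σ (x : X)) :
    T2Space (OrbitSpace σ S) := by
  have : CompactSpace S := isCompact_iff_compactSpace.1 hS.isCompact
  obtain ⟨N, hN⟩ := hloc.range_finite.bddAbove
  rw [t2Space_iff_of_isOpenQuotientMap (isOpenQuotientMap_orbitSpace_mk hinv)]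
  have h : {q : S × S | Quotient.mk (orbitSetoid σ S) q.1 = Quotient.mk _ q.2}
      = ⋃ k ∈ Finset.range N, {q : S × S | (σ ^ (k : ℤ) : X ≃ₜ X) (q.1 : X) = q.2} := by
    ext ⟨x, y⟩
    simp only [mem_ofPred_eq, mem_iUnion, orbitSpace_mk_eq_iff, exists_prop, Finset.mem_range]
    constructor
    · rintro ⟨n, hn⟩
      have hp : (0 : ℤ) < Function.minimalPeriod σ (x : X) := by
        exact_mod_cast Function.minimalPeriod_pos_of_mem_periodicPts (hper x.2)
      have h0 := Int.emod_nonneg n hp.ne'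
      have h1 := Int.emod_lt_of_pos n hp
      have h2 : Function.minimalPeriod σ (x : X) ≤ N := hN ⟨x, rfl⟩
      refine ⟨(n % (Function.minimalPeriod σ (x : X) : ℤ)).toNat, by omega, ?_⟩
      rw [Int.toNat_of_nonneg h0, homeo_zpow_emod_apply, hn]
    · rintro ⟨k, -, hk⟩
      exact ⟨k, hk⟩
  rw [h]
  refine isClosed_biUnion_finset fun k _ => isClosed_eq ?_ (by fun_prop)
  exact (σ ^ (k : ℤ) : X ≃ₜ X).continuous.comp (by fun_prop)

theorem compactSpace_orbitSpace [CompactSpace X] (hS : IsClosed S) :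
    CompactSpace (OrbitSpace σ S) := by
  have : CompactSpace S := isCompact_iff_compactSpace.1 hS.isCompact
  infer_instance

end OrbitSpaceTopology

/-! ### The homeomorphism `(S/ℤ) × 𝕋 → Π_S` -/

section OrbitMap

variable {X : Type u} [TopologicalSpace X] [CompactSpace X] [T2Space X] {σ : X ≃ₜ X} {S : Set X}

/-- The map `(𝔬, λ) ↦ P_{𝔬,λ}` for a set of periodic points. -/
noncomputable def orbitMap (hper : S ⊆ Function.periodicPts σ) (q : OrbitSpace σ S × Circle) :
    structureSet σ S :=
  Quotient.lift
    (fun x : S => (⟨⟨_, isPrimitiveIdeal_ker_periodicRep (hper x.2) q.2⟩,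
      Or.inl ⟨x, x.2, hper x.2, q.2, rfl⟩⟩ : structureSet σ S))
    (fun x y h => by
      obtain ⟨n, hn⟩ := h
      refine Subtype.ext (Subtype.ext ?_)
      change TwoSidedIdeal.ker (periodicRep σ x q.2) = TwoSidedIdeal.ker (periodicRep σ y q.2)
      rw [← hn, ker_periodicRep_zpow _ (hper x.2)]) q.1

theorem mem_orbitMap_mk_ideal (hper : S ⊆ Function.periodicPts σ) (x : S) (lam : Circle)
    (a : EllOne σ) : a ∈ (orbitMap hper (Quotient.mk _ x, lam)).1.ideal ↔
      ∀ i k : ℤ, fiberSeries (Function.minimalPeriod σ (x : X)) i k a x lam = 0 :=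
  mem_ker_periodicRep_iff a (hper x.2) lam

theorem orbitMap_surjective (hper : S ⊆ Function.periodicPts σ) :
    Function.Surjective (orbitMap hper) := by
  rintro ⟨P, ⟨x, hx, -, lam, hP⟩ | ⟨x, hx, hx', -⟩⟩
  · exact ⟨(Quotient.mk _ ⟨x, hx⟩, lam), Subtype.ext (Subtype.ext hP.symm)⟩
  · exact (hx' (hper hx)).elim

/-- Uniform convergence: the terms are dominated by the norms `‖a(pm + k)‖`, and `p > 0` makes these
indices distinct. -/
theorem continuous_fiberSeries {p : ℕ} (hp : 0 < p) (i k : ℤ) (a : EllOne σ) :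
    Continuous fun q : X × Circle => fiberSeries p i k a q.1 q.2 := by
  have hinj : Function.Injective fun m : ℤ => (p : ℤ) * m + k := fun m n h => by
    simpa [hp.ne'] using h
  refine continuous_tsum (fun m => ?_) ((EllOne.summable_norm a).comp_injective hinj) fun m q => ?_
  · refine Continuous.mul ?_ ?_
    · exact (a (p * m + k)).continuous.comp ((σ ^ i : X ≃ₜ X).continuous.comp continuous_fst)
    · exact (continuous_subtype_val.comp continuous_snd).zpow₀ m fun q =>
        Or.inl (Circle.coe_ne_zero _)
  · rw [norm_mul, norm_zpow, Circle.norm_coe, one_zpow, mul_one]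
    exact EllOne.norm_apply_apply_le _ _ _

/-- A hull-kernel closed set pulls back to the common zero set of the fibre series of the elements
of its kernel. Although `p` in the series depends on the point, it can be frozen locally. -/
theorem continuous_orbitMap (hinv : σ '' S = S) (hper : S ⊆ Function.periodicPts σ)
    (hloc : IsLocallyConstant fun x : S => Function.minimalPeriod σ (x : X)) :
    Continuous (orbitMap (σ := σ) hper) := by
  -- Openness of the orbit map is what makes its product with the identity a quotient map.
  have hq : IsQuotientMap (Prod.map (Quotient.mk (orbitSetoid σ S)) (id : Circle → Circle)) :=
    ((isOpenQuotientMap_orbitSpace_mk hinv).prodMap .id).isQuotientMap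
  rw [hq.continuous_iff, continuous_induced_rng, continuous_iff_isClosed]
  intro F hF
  have h : (Subtype.val ∘ orbitMap hper ∘ Prod.map (Quotient.mk (orbitSetoid σ S)) id) ⁻¹' F
      = ⋂ a ∈ StructureSpace.kernel F, ⋂ (i : ℤ) (k : ℤ), {q : S × Circle |
        fiberSeries (Function.minimalPeriod σ (q.1 : X)) i k a (q.1 : X) q.2 = 0} := by
    ext ⟨x, lam⟩
    simp only [mem_iInter, mem_ofPred_eq, ← mem_orbitMap_mk_ideal hper x lam]
    exact ⟨fun h a ha => StructureSpace.kernel_le h ha,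
      fun h => StructureSpace.isClosed_iff.1 hF fun a ha => h a ha⟩
  rw [h]
  refine isClosed_biInter fun a _ => isClosed_iInter fun i => isClosed_iInter fun k =>
    isClosed_eq ?_ continuous_const
  refine continuous_iff_continuousAt.2 fun q₀ => ?_
  have hc := continuous_fiberSeries
    (Function.minimalPeriod_pos_of_mem_periodicPts (hper q₀.1.2)) i k a
  refine ContinuousAt.congr (f := fun q : S × Circle =>
    fiberSeries (Function.minimalPeriod σ (q₀.1 : X)) i k a (q.1 : X) q.2) ?_ ?_
  · exact (hc.comp (by fun_prop :
      Continuous fun q : S × Circle => ((q.1 : X), q.2))).continuousAt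
  · have : ∀ᶠ x : S in 𝓝 q₀.1,
        Function.minimalPeriod σ (x : X) = Function.minimalPeriod σ (q₀.1 : X) :=
      hloc.eventually_eq q₀.1
    filter_upwards [continuous_fst.continuousAt.eventually this] with q hq
    rw [hq]

/-- The element with coefficients `c m • f` at `pm`. -/
noncomputable def spreadElement (σ : X ≃ₜ X) {p : ℕ} (hp : p ≠ 0) {c : ℤ → ℂ}
    (hc : Summable fun n => ‖c n‖) (f : C(X, ℂ)) : EllOne σ :=
  EllOne.mk (fun n => spread p c n • f) (by
    simpa only [norm_smul] using (summable_norm_spread hp hc).mul_right ‖f‖)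

theorem fiberSeries_spreadElement_eq_zero_of_apply {p : ℕ} (hp : p ≠ 0) {c : ℤ → ℂ}
    (hc : Summable fun n => ‖c n‖) (f : C(X, ℂ)) (P : ℕ) (i k : ℤ) (x : X) (lam : Circle)
    (hf : f ((σ ^ i : X ≃ₜ X) x) = 0) :
    fiberSeries P i k (spreadElement σ hp hc f) x lam = 0 := by
  rw [fiberSeries, ← tsum_zero (α := ℂ) (β := ℤ)]
  refine tsum_congr fun m => ?_
  change spread p c _ * f ((σ ^ i : X ≃ₜ X) x) * _ = 0
  rw [hf, mul_zero, zero_mul]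

theorem fiberSeries_spreadElement_zero {p : ℕ} (hp : p ≠ 0) {c : ℤ → ℂ}
    (hc : Summable fun n => ‖c n‖) (f : C(X, ℂ)) (i : ℤ) (x : X) (lam : Circle) :
    fiberSeries p i 0 (spreadElement σ hp hc f) x lam
      = f ((σ ^ i : X ≃ₜ X) x) * ∑' m, c m * (lam : ℂ) ^ m := by
  rw [fiberSeries, ← tsum_mul_left]
  refine tsum_congr fun m => ?_
  change spread p c (p * m + 0) * f ((σ ^ i : X ≃ₜ X) x) * _ = _
  rw [add_zero, spread_mul hp]
  ring

/-- For `k ∉ pℤ` the series meets no coefficient in the support `pℤ`; for `k ∈ pℤ` it is a multiple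
of the Fourier series of `c` at `λ`. -/
theorem fiberSeries_spreadElement_eq_zero {p : ℕ} (hp : p ≠ 0) {c : ℤ → ℂ}
    (hc : Summable fun n => ‖c n‖) (f : C(X, ℂ)) (i k : ℤ) (x : X) (lam : Circle)
    (hlam : ∑' m, c m * (lam : ℂ) ^ m = 0) :
    fiberSeries p i k (spreadElement σ hp hc f) x lam = 0 := by
  by_cases hk : (p : ℤ) ∣ k
  · obtain ⟨t, rfl⟩ := hk
    rw [← zero_add ((p : ℤ) * t), fiberSeries_add_mul, fiberSeries_spreadElement_zero, hlam,
      mul_zero, mul_zero]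
  · rw [fiberSeries, ← tsum_zero (α := ℂ) (β := ℤ)]
    refine tsum_congr fun m => ?_
    change spread p c (p * m + k) * f ((σ ^ i : X ≃ₜ X) x) * _ = 0
    rw [spread_of_not_dvd (fun h => hk ((Int.dvd_add_right (dvd_mul_right _ _)).1 h)), zero_mul,
      zero_mul]

/-- The algebra separates points `P_{𝔬,λ}` from closed sets of the parameter space. -/
theorem exists_mem_ideal_of_notMem (hS : IsClosed S) (hinv : σ '' S = S)
    (hper : S ⊆ Function.periodicPts σ)
    (hloc : IsLocallyConstant fun x : S => Function.minimalPeriod σ (x : X))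
    {C : Set (OrbitSpace σ S × Circle)} (hC : IsClosed C) {q₀ : OrbitSpace σ S × Circle}
    (hq₀ : q₀ ∉ C) : ∃ a : EllOne σ, (∀ q ∈ C, a ∈ (orbitMap hper q).1.ideal) ∧
      a ∉ (orbitMap hper q₀).1.ideal := by
  have := t2Space_orbitSpace hS hinv hper hloc
  have : CompactSpace (OrbitSpace σ S) := compactSpace_orbitSpace hS
  obtain ⟨o₀, mu⟩ := q₀
  obtain ⟨x₀, rfl⟩ := Quotient.exists_rep o₀
  obtain ⟨U, V, hU, hV, hxU, hmuV, hUV⟩ := isOpen_prod_iff.1 hC.isOpen_compl _ _ hq₀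
  set p := Function.minimalPeriod σ (x₀ : X) with hpdef
  have hp : p ≠ 0 := (Function.minimalPeriod_pos_of_mem_periodicPts (hper x₀.2)).ne'
  -- `W` keeps only orbits of period exactly `p`, since coefficients spread over `pℤ` reproduce the
  -- Fourier series of `c` only for that period.
  set W : Set (OrbitSpace σ S) :=
    U ∩ Quotient.mk (orbitSetoid σ S) '' {x | Function.minimalPeriod σ (x : X) = p} with hW
  have hWo : IsOpen W := hU.inter
    ((isOpenQuotientMap_orbitSpace_mk hinv).isOpenMap _ (hloc.isOpen_fiber p))
  have hx₀W : Quotient.mk (orbitSetoid σ S) x₀ ∈ W := ⟨hxU, x₀, rfl, rfl⟩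
  obtain ⟨g, hg0, hg1, -⟩ := exists_continuous_zero_one_of_isClosed hWo.isClosed_compl
    (isClosed_singleton (x := Quotient.mk (orbitSetoid σ S) x₀))
    (disjoint_singleton_right.2 fun h => h hx₀W)
  -- Tietze extension from `S` to `X`. Invariance on `S` is all that is needed, as the orbits
  -- concerned stay in `S`.
  obtain ⟨f, hf⟩ := ContinuousMap.exists_restrict_eq hS
    (⟨fun x : S => ((g (Quotient.mk (orbitSetoid σ S) x) : ℝ) : ℂ),
      Complex.continuous_ofReal.comp (g.continuous.comp continuous_quotient_mk')⟩ : C(S, ℂ))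
  have hfS : ∀ (x : S) (i : ℤ), f ((σ ^ i : X ≃ₜ X) (x : X))
      = ((g (Quotient.mk (orbitSetoid σ S) x) : ℝ) : ℂ) := fun x i => by
    have h1 := DFunLike.congr_fun hf ⟨(σ ^ i : X ≃ₜ X) (x : X), homeo_zpow_mem hinv x.2 i⟩
    refine h1.trans ?_
    change ((g (Quotient.mk (orbitSetoid σ S) _) : ℝ) : ℂ) = _
    rw [orbitSpace_mk_eq_iff.2 (⟨i, rfl⟩ : ∃ n : ℤ, (σ ^ n : X ≃ₜ X) (x : X)
      = (⟨(σ ^ i : X ≃ₜ X) (x : X), homeo_zpow_mem hinv x.2 i⟩ : S))]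
  obtain ⟨c, hc, hc0, hc1⟩ := exists_fourier_bump (hV.mem_nhds hmuV)
  refine ⟨spreadElement σ hp hc f, ?_, fun h => ?_⟩
  · rintro ⟨o, lam⟩ hq
    obtain ⟨x, rfl⟩ := Quotient.exists_rep o
    rw [mem_orbitMap_mk_ideal]
    intro i k
    -- For orbits in `W` the pair avoids `C` only in the circle direction, so `λ ∉ V` and the
    -- Fourier factor vanishes; for orbits outside `W` the function factor does.
    by_cases hxW : Quotient.mk (orbitSetoid σ S) x ∈ W
    · obtain ⟨hxU, x', hx', hxx'⟩ := hxW
      obtain ⟨n, hn⟩ := orbitSpace_mk_eq_iff.1 hxx'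
      have hpx : Function.minimalPeriod σ (x : X) = p := by
        rw [← hn, minimalPeriod_homeo_zpow_apply]
        exact hx'
      rw [hpx]
      exact fiberSeries_spreadElement_eq_zero hp hc f i k x lam
        (hc0 lam fun hl => hUV (⟨hxU, hl⟩ : (_, _) ∈ U ×ˢ V) hq)
    · refine fiberSeries_spreadElement_eq_zero_of_apply hp hc f _ i k x lam ?_
      rw [hfS, hg0 hxW]
      simp
  · have h1 := (mem_orbitMap_mk_ideal hper x₀ mu _).1 h 0 0
    rw [fiberSeries_spreadElement_zero, hfS, hg1 rfl] at h1
    simp only [Pi.one_apply, Complex.ofReal_one, one_mul] at h1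
    exact hc1 h1

theorem orbitMap_injective (hS : IsClosed S) (hinv : σ '' S = S)
    (hper : S ⊆ Function.periodicPts σ)
    (hloc : IsLocallyConstant fun x : S => Function.minimalPeriod σ (x : X)) :
    Function.Injective (orbitMap (σ := σ) hper) := by
  intro q q' h
  by_contra hne
  have := t2Space_orbitSpace hS hinv hper hloc
  obtain ⟨a, ha, ha'⟩ := exists_mem_ideal_of_notMem hS hinv hper hloc
    (isClosed_singleton (x := q')) (show q ∉ {q'} from hne)
  exact ha' (h ▸ ha q' rfl)

/-- A point in the closure of the image of `C` contains the kernel of that image. If it were not in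
the image, the separating element would belong to the kernel but not to the point. -/
theorem isClosedMap_orbitMap (hS : IsClosed S) (hinv : σ '' S = S)
    (hper : S ⊆ Function.periodicPts σ)
    (hloc : IsLocallyConstant fun x : S => Function.minimalPeriod σ (x : X)) :
    IsClosedMap (orbitMap (σ := σ) hper) := by
  refine fun C hC => isClosed_of_closure_subset fun P hP => ?_
  rw [closure_subtype, StructureSpace.closure_eq] at hP
  obtain ⟨q, rfl⟩ := orbitMap_surjective hper P
  by_contra hq
  obtain ⟨a, ha, ha'⟩ := exists_mem_ideal_of_notMem hS hinv hper hloc hC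
    fun h => hq (mem_image_of_mem _ h)
  refine ha' (hP (StructureSpace.mem_kernel.2 ?_))
  rintro _ ⟨_, ⟨q', hq', rfl⟩, rfl⟩
  exact ha q' hq'

/-- `(S/ℤ) × 𝕋 → Π_S` is a homeomorphism for closed invariant sets of periodic points on which the
period is locally constant. -/
noncomputable def orbitHomeomorph (hS : IsClosed S) (hinv : σ '' S = S)
    (hper : S ⊆ Function.periodicPts σ)
    (hloc : IsLocallyConstant fun x : S => Function.minimalPeriod σ (x : X)) :
    OrbitSpace σ S × Circle ≃ₜ structureSet σ S :=
  (Equiv.ofBijective (orbitMap hper)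
    ⟨orbitMap_injective hS hinv hper hloc, orbitMap_surjective hper⟩).toHomeomorphOfContinuousClosed
    (continuous_orbitMap hinv hper hloc) (isClosedMap_orbitMap hS hinv hper hloc)

end OrbitMap

/-! ### Finite disjoint unions -/

section DisjointUnion

variable {X : Type u} [TopologicalSpace X] [CompactSpace X] {σ : X ≃ₜ X}

theorem structureSet_mono {S T : Set X} (h : S ⊆ T) : structureSet σ S ⊆ structureSet σ T := by
  rintro P (⟨x, hx, H⟩ | ⟨x, hx, H⟩)
  · exact Or.inl ⟨x, h hx, H⟩
  · exact Or.inr ⟨x, h hx, H⟩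

/-- The preimage of any set of integers is a finite union of traces of the closed sets `S i`, hence
closed; the target is discrete. -/
theorem isLocallyConstant_minimalPeriod_iUnion {ι : Type*} [Finite ι] {S : ι → Set X} {p : ι → ℕ}
    (hS : ∀ i, IsClosed (S i)) (hp : ∀ i, S i ⊆ perPoints σ (p i)) :
    IsLocallyConstant fun x : (⋃ i, S i : Set X) => Function.minimalPeriod σ (x : X) := by
  refine (IsLocallyConstant.iff_continuous _).2 (continuous_iff_isClosed.2 fun F _ => ?_)
  have : (fun x : (⋃ i, S i : Set X) => Function.minimalPeriod σ (x : X)) ⁻¹' F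
      = ⋃ i ∈ {i | p i ∈ F}, Subtype.val ⁻¹' S i := by
    ext x
    simp only [mem_preimage, mem_iUnion, mem_ofPred_eq, exists_prop]
    constructor
    · intro hx
      obtain ⟨i, hi⟩ := mem_iUnion.1 x.2
      have hpi : Function.minimalPeriod σ (x : X) = p i := hp i hi
      exact ⟨i, hpi ▸ hx, hi⟩
    · rintro ⟨i, hF, hi⟩
      have hpi : Function.minimalPeriod σ (x : X) = p i := hp i hi
      rwa [hpi]
  rw [this]
  exact (Set.toFinite _).isClosed_biUnion fun i _ => (hS i).preimage continuous_subtype_val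

end DisjointUnion

/-! ### Assembly of the two statements -/

theorem mainTheorem6 {X : Type u} [TopologicalSpace X] [CompactSpace X] [T2Space X] [Nonempty X]
    (σ : X ≃ₜ X) :
    -- `Π_X` is compact if `X` is metrizable or `X = Per(σ)`
    ((TopologicalSpace.MetrizableSpace X ∨ Function.periodicPts σ = Set.univ) →
      IsCompact (structureSet σ Set.univ)) ∧
    -- the description of `Π_S` whenever `Π_X` is compact
    (IsCompact (structureSet σ Set.univ) →
      ∀ (n : ℕ) (S : Fin n → Set X) (p : Fin n → ℕ),
        (∀ i, 1 ≤ p i) →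
        (∀ i, IsClosed (S i)) →
        (∀ i, σ '' S i = S i) →
        (∀ i j, i ≠ j → Disjoint (S i) (S j)) →
        (∀ i, S i ⊆ perPoints σ (p i)) →
        (CompactSpace (OrbitSpace σ (⋃ i, S i) × Circle) ∧
          T2Space (OrbitSpace σ (⋃ i, S i) × Circle) ∧
          CompactSpace (structureSet σ (⋃ i, S i)) ∧
          T2Space (structureSet σ (⋃ i, S i))) ∧
        (∃ Ψ : OrbitSpace σ (⋃ i, S i) × Circle ≃ₜ structureSet σ (⋃ i, S i),
          ∀ (x : (⋃ i, S i : Set X)) (lam : Circle),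
            (Ψ (Quotient.mk _ x, lam)).1.ideal = TwoSidedIdeal.ker (periodicRep σ x lam)) ∧
        (∃ e : (Σ i, structureSet σ (S i)) ≃ₜ structureSet σ (⋃ i, S i),
          ∀ (i : Fin n) (P : structureSet σ (S i)), (e ⟨i, P⟩).1 = P.1) ∧
        (∀ i, ∃ Ψ : OrbitSpace σ (S i) × Circle ≃ₜ structureSet σ (S i),
          ∀ (x : S i) (lam : Circle),
            (Ψ (Quotient.mk _ x, lam)).1.ideal = TwoSidedIdeal.ker (periodicRep σ x lam))) := by
  refine ⟨fun _ => isCompact_structureSet_univ σ, fun _ n S p hp hS hinv hdisj hSp => ?_⟩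
  have hper : ∀ i, S i ⊆ Function.periodicPts σ := fun i x hx => by
    have h : Function.minimalPeriod σ x = p i := hSp i hx
    exact Function.minimalPeriod_pos_iff_mem_periodicPts.1 (h ▸ hp i)
  have hloc : ∀ i, IsLocallyConstant fun x : S i => Function.minimalPeriod σ (x : X) := fun i =>
    IsLocallyConstant.of_constant _ fun x y => (hSp i x.2).trans (hSp i y.2).symm
  have hUS : IsClosed (⋃ i, S i) := isClosed_iUnion_of_finite hS
  have hUinv : σ '' (⋃ i, S i) = ⋃ i, S i := by rw [image_iUnion]; simp only [hinv]
  have hUper : (⋃ i, S i) ⊆ Function.periodicPts σ := iUnion_subset hper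
  have hUloc := isLocallyConstant_minimalPeriod_iUnion hS hSp
  have hcompact : ∀ {T : Set X}, IsClosed T → CompactSpace (OrbitSpace σ T × Circle) :=
    fun hT => by
      have := compactSpace_orbitSpace (σ := σ) hT
      infer_instance
  have hUc := hcompact hUS
  have hUt : T2Space (OrbitSpace σ (⋃ i, S i) × Circle) := by
    have := t2Space_orbitSpace hUS hUinv hUper hUloc
    infer_instance
  let Ψ := orbitHomeomorph hUS hUinv hUper hUloc
  have hT2 : T2Space (structureSet σ (⋃ i, S i)) := Ψ.t2Space
  refine ⟨⟨hUc, hUt, Ψ.compactSpace, hT2⟩, ⟨Ψ, fun _ _ => rfl⟩, ?_,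
    fun i => ⟨orbitHomeomorph (hS i) (hinv i) (hper i) (hloc i), fun _ _ => rfl⟩⟩
  have hcpt : ∀ i, CompactSpace (structureSet σ (S i)) := fun i => by
    have := hcompact (hS i)
    exact (orbitHomeomorph (hS i) (hinv i) (hper i) (hloc i)).compactSpace
  let e : (Σ i, structureSet σ (S i)) → structureSet σ (⋃ i, S i) := fun P =>
    ⟨P.2.1, structureSet_mono (subset_iUnion S P.1) P.2.2⟩
  have hcont : Continuous e :=
    continuous_sigma fun i => continuous_subtype_val.subtype_mk _
  have hinj : Function.Injective e := by
    rintro ⟨i, P⟩ ⟨j, Q⟩ h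
    have hPQ : P.1 = Q.1 := congrArg Subtype.val h
    obtain ⟨⟨o, lam⟩, hq⟩ := orbitMap_surjective (hper i) P
    obtain ⟨⟨o', lam'⟩, hq'⟩ := orbitMap_surjective (hper j) Q
    obtain ⟨x, rfl⟩ := Quotient.exists_rep o
    obtain ⟨y, rfl⟩ := Quotient.exists_rep o'
    -- Both parameters are viewed over the whole union, where injectivity puts `x` and `y` in one
    -- orbit. Invariance of `S i` and disjointness then force `i = j`.
    have hxy : orbitMap hUper (Quotient.mk _ ⟨x, mem_iUnion_of_mem i x.2⟩, lam)
        = orbitMap hUper (Quotient.mk _ ⟨y, mem_iUnion_of_mem j y.2⟩, lam') := by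
      refine Subtype.ext ?_
      change (orbitMap (hper i) (Quotient.mk _ x, lam)).1
        = (orbitMap (hper j) (Quotient.mk _ y, lam')).1
      rw [hq, hq', hPQ]
    obtain ⟨m, hm⟩ := orbitSpace_mk_eq_iff.1
      (congrArg Prod.fst (orbitMap_injective hUS hUinv hUper hUloc hxy))
    have hyi : (y : X) ∈ S i := hm ▸ homeo_zpow_mem (hinv i) x.2 m
    have hij : i = j := by
      by_contra hij
      exact Set.disjoint_left.1 (hdisj i j hij) hyi y.2
    subst hij
    exact congrArg _ (Subtype.ext hPQ)
  have hsurj : Function.Surjective e := by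
    rintro ⟨P, ⟨x, hx, H⟩ | ⟨x, hx, H⟩⟩
    · obtain ⟨i, hi⟩ := mem_iUnion.1 hx
      exact ⟨⟨i, P, Or.inl ⟨x, hi, H⟩⟩, rfl⟩
    · obtain ⟨i, hi⟩ := mem_iUnion.1 hx
      exact ⟨⟨i, P, Or.inr ⟨x, hi, H⟩⟩, rfl⟩
  -- The source is a finite disjoint union of compact spaces and the target is Hausdorff, so
  -- continuity of the bijection suffices.
  exact ⟨Continuous.homeoOfEquivCompactToT2 (f := Equiv.ofBijective e ⟨hinj, hsurj⟩) hcont,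
    fun _ _ => rfl⟩
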